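/- Let $\mathfrak n$ be a finite-dimensional real Lie algebra with a positive definite inner product $\langle\cdot,\cdot\rangle$ (no compatibility with the bracket is assumed), let $\mathfrak z$ be its center and $\mathfrak v=\mathfrak z^{\perp}$. For $Z\in\mathfrak z$ let $j_Z:\mathfrak v\to\mathfrak v$ be the linear map defined by $\langle j_ZV,W\rangle=\langle Z,[V,W]\rangle$ for all $V,W\in\mathfrak v$. Assume that $\mathfrak n$ is of type $H$, that is, $[[U,V],W]=0$ for all $U,V,W\in\mathfrak n$, and $j_Z$ is orthogonal for every $Z\in\mathfrak z$ with $\langle Z,Z\rangle=1$. Then the following are equivalent. 1. $\mathfrak n$ admits a non-trivial Lorentz force of type II, that is, there is a linear map $F:\mathfrak n\to\mathfrak n$, $F\neq0$, which is skew-symmetric with respect to $\langle\cdot,\cdot\rangle$, whose associated left-invariant 2-form $\omega(X,Y)=\langle F(X),Y\rangle$ is closed, i.e. $$\langle F(U),[V,W]\rangle+\langle F(V),[W,U]\rangle+\langle F(W),[U,V]\rangle=0\qquad\text{for all }U,V,W\in\mathfrak n,$$ and which satisfies $F(\mathfrak v)\subseteq\mathfrak z$ and $F(\mathfrak z)\subseteq\mathfrak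 v$. (For a skew-symmetric $F$ with the last two inclusions, closedness is equivalent to condition (C2): the displayed identity for all $U,V,W\in\mathfrak v$.) 2. $\mathfrak n$ is isomorphic, as a real Lie algebra, to one of the following: the $3$-dimensional Heisenberg algebra, with basis $e_1,e_2,e_3$ and only non-trivial bracket $[e_1,e_2]=e_3$; the $6$-dimensional complex Heisenberg algebra, i.e. the real Lie algebra underlying the complex Lie algebra with $\mathbb C$-basis $e_1,e_2,e_3$ and only non-trivial bracket $[e_1,e_2]=e_3$; the $7$-dimensional quaternionic Heisenberg algebra $\mathbb H\oplus\operatorname{Im}\mathbb H$, with $\operatorname{Im}\mathbb H$ central and $[u,v]=-\operatorname{Im}(u\bar v)$ for $u,v\in\mathbb H$. -/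

import Mathlib

/-- A metric (positive definite real inner product) on the underlying vector space of a real
Lie algebra `L`.  No compatibility with the Lie bracket is required; this is the datum of a
left-invariant Riemannian metric on a Lie group with Lie algebra `L`. -/
structure LieMetric (L : Type*) [LieRing L] [LieAlgebra ℝ L] where
  /-- the bilinear form `⟨·, ·⟩` -/
  form : LinearMap.BilinForm ℝ L
  symm : ∀ x y : L, form x y = form y x
  pos : ∀ x : L, x ≠ 0 → 0 < form x x

namespace LieMetric

section

variable {L : Type*} [LieRing L] [LieAlgebra ℝ L] (g : LieMetric L)

/-- The center `𝔷` of `L`, as a real subspace. -/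
def centerSpace (L : Type*) [LieRing L] [LieAlgebra ℝ L] : Submodule ℝ L :=
  (LieAlgebra.center ℝ L).toSubmodule

/-- The orthogonal complement `𝔳 = 𝔷^⊥` of the center with respect to the metric. -/
def vSpace : Submodule ℝ L :=
  g.form.orthogonal (centerSpace L)

theorem mem_centerSpace {x : L} : x ∈ centerSpace L ↔ ∀ y : L, ⁅y, x⁆ = 0 := by
  simp [centerSpace, LieModule.mem_maxTrivSubmodule]

theorem mem_vSpace {x : L} : x ∈ g.vSpace ↔ ∀ z ∈ centerSpace L, g.form z x = 0 := by
  simp [vSpace, LinearMap.BilinForm.mem_orthogonal_iff]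

/-- The metric restricted to `𝔳` is nondegenerate. -/
theorem nondegenerate_restrict_vSpace : (g.form.restrict g.vSpace).Nondegenerate := by
  constructor
  · intro x hx
    by_contra h
    have h' : (x : L) ≠ 0 := fun e => h (Subtype.ext e)
    exact (g.pos x h').ne' (hx x)
  · intro x hx
    by_contra h
    have h' : (x : L) ≠ 0 := fun e => h (Subtype.ext e)
    exact (g.pos x h').ne' (hx x)

/-- The bilinear form `(V, W) ↦ ⟨Z, [V, W]⟩` on `𝔳`. -/
def bracketForm (Z : L) : g.vSpace →ₗ[ℝ] Module.Dual ℝ g.vSpace :=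
  LinearMap.mk₂ ℝ (fun V W : g.vSpace => g.form Z ⁅(V : L), (W : L)⁆)
    (by intros; simp) (by intros; simp) (by intros; simp) (by intros; simp)

variable [FiniteDimensional ℝ L]

/-- The map `j_Z : 𝔳 → 𝔳`, determined by `⟨j_Z V, W⟩ = ⟨Z, [V, W]⟩` for all `V, W ∈ 𝔳`. -/
noncomputable def j (Z : L) : g.vSpace →ₗ[ℝ] g.vSpace :=
  ((g.form.restrict g.vSpace).toDual g.nondegenerate_restrict_vSpace).symm.toLinearMap ∘ₗ
    g.bracketForm Z

/-- The defining property of `j_Z`. -/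
theorem form_j (Z : L) (V W : g.vSpace) :
    g.form (g.j Z V : L) (W : L) = g.form Z ⁅(V : L), (W : L)⁆ :=
  LinearMap.BilinForm.apply_toDual_symm_apply (hB := g.nondegenerate_restrict_vSpace)
    (g.bracketForm Z V) W

/-- `(L, g)` is a Lie algebra of type H: `L` is 2-step nilpotent (`[[U, V], W] = 0`) and
`j_Z : 𝔳 → 𝔳` is orthogonal for every `Z` in the center with `⟨Z, Z⟩ = 1`. -/
structure IsTypeH : Prop where
  two_step : ∀ U V W : L, ⁅⁅U, V⁆, W⁆ = 0
  orthogonal_j : ∀ Z ∈ centerSpace L, g.form Z Z = 1 →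
    ∀ V W : g.vSpace, g.form (g.j Z V : L) (g.j Z W : L) = g.form (V : L) (W : L)

end

section

variable {L : Type*} [LieRing L] [LieAlgebra ℝ L] (g : LieMetric L)

/-- `F` is a Lorentz force: it is skew-symmetric, and the left-invariant 2-form
`ω(X, Y) = ⟨F X, Y⟩` is closed, i.e. `ω(U, [V, W]) + ω(V, [W, U]) + ω(W, [U, V]) = 0`. -/
structure IsLorentzForce (F : L →ₗ[ℝ] L) : Prop where
  skew : ∀ X Y : L, g.form (F X) Y = -g.form X (F Y)
  closed : ∀ U V W : L,
    g.form (F U) ⁅V, W⁆ + g.form (F V) ⁅W, U⁆ + g.form (F W) ⁅U, V⁆ = 0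

/-- `F` is of type II: `F(𝔳) ⊆ 𝔷` and `F(𝔷) ⊆ 𝔳`. -/
structure IsTypeII (F : L →ₗ[ℝ] L) : Prop where
  map_v : ∀ V ∈ g.vSpace, F V ∈ centerSpace L
  map_z : ∀ Z ∈ centerSpace L, F Z ∈ g.vSpace

end

/-- On a finite-dimensional 2-step nilpotent Lie algebra, closedness of a skew-symmetric map of
type II amounts to the closedness condition on `𝔳`, usually called (C2). -/
theorem isLorentzForce_iff_of_isTypeII {L : Type*} [LieRing L] [LieAlgebra ℝ L]
    [FiniteDimensional ℝ L] (g : LieMetric L) (h2 : ∀ U V W : L, ⁅⁅U, V⁆, W⁆ = 0)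
    {F : L →ₗ[ℝ] L} (hII : g.IsTypeII F) :
    g.IsLorentzForce F ↔
      (∀ X Y : L, g.form (F X) Y = -g.form X (F Y)) ∧
      ∀ U ∈ g.vSpace, ∀ V ∈ g.vSpace, ∀ W ∈ g.vSpace,
        g.form (F U) ⁅V, W⁆ + g.form (F V) ⁅W, U⁆ + g.form (F W) ⁅U, V⁆ = 0 := by
  refine ⟨fun h => ⟨h.skew, fun U _ V _ W _ => h.closed U V W⟩, fun ⟨hs, hc⟩ => ⟨hs, ?_⟩⟩
  have hcompl : IsCompl (centerSpace L) g.vSpace := by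
    refine LinearMap.BilinForm.isCompl_orthogonal_of_restrict_nondegenerate
      (fun x y h => by rw [g.symm]; exact h) ?_
    constructor
    · intro x hx
      by_contra h
      exact (g.pos x (fun e => h (Subtype.ext e))).ne' (hx x)
    · intro x hx
      by_contra h
      exact (g.pos x (fun e => h (Subtype.ext e))).ne' (hx x)
  have hbr : ∀ X Y : L, ⁅X, Y⁆ ∈ centerSpace L := fun X Y => by
    rw [mem_centerSpace]
    intro W
    rw [← lie_skew, h2, neg_zero]
  have hz : ∀ Z ∈ centerSpace L, ∀ X Y : L, g.form (F Z) ⁅X, Y⁆ = 0 := fun Z hZ X Y => by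
    rw [g.symm]
    exact (g.mem_vSpace.1 (hII.map_z Z hZ)) _ (hbr X Y)
  have hd : ∀ X : L, ∃ z ∈ centerSpace L, ∃ v ∈ g.vSpace, z + v = X := fun X =>
    Submodule.mem_sup.1 (hcompl.sup_eq_top ▸ Submodule.mem_top)
  have hl : ∀ z ∈ centerSpace L, ∀ X : L, ⁅z, X⁆ = 0 := fun z hZ X => by
    rw [← lie_skew, mem_centerSpace.1 hZ X, neg_zero]
  have hr : ∀ z ∈ centerSpace L, ∀ X : L, ⁅X, z⁆ = 0 := fun z hZ X => mem_centerSpace.1 hZ X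
  intro U V W
  obtain ⟨u₀, hu₀, u, hu, rfl⟩ := hd U
  obtain ⟨v₀, hv₀, v, hv, rfl⟩ := hd V
  obtain ⟨w₀, hw₀, w, hw, rfl⟩ := hd W
  simpa [hz _ hu₀, hz _ hv₀, hz _ hw₀, hl _ hu₀, hl _ hv₀, hl _ hw₀, hr _ hu₀, hr _ hv₀, hr _ hw₀]
    using hc u hu v hv w hw

end LieMetric

/-- The Heisenberg Lie algebra `K³` over `K`, with `[(x, y, z), (x', y', z')] = (0, 0, x y' - y x')`,
that is, `[e₁, e₂] = e₃`; below it is regarded as a real Lie algebra. -/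
def HeisenbergAlgebra (K : Type) : Type := K × K × K

namespace HeisenbergAlgebra

variable {K : Type} [CommRing K] [Algebra ℝ K]

instance : AddCommGroup (HeisenbergAlgebra K) := inferInstanceAs (AddCommGroup (K × K × K))

instance : Module ℝ (HeisenbergAlgebra K) := inferInstanceAs (Module ℝ (K × K × K))

instance : Bracket (HeisenbergAlgebra K) (HeisenbergAlgebra K) :=
  ⟨fun a b => ((0, 0, a.1 * b.2.1 - a.2.1 * b.1) : K × K × K)⟩

instance : LieRing (HeisenbergAlgebra K) where
  add_lie a b c := by
    change ((_, _, _) : K × K × K) = (0 + 0, 0 + 0, _ + _)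
    refine Prod.ext (by simp) (Prod.ext (by simp) ?_)
    change (a.1 + b.1) * c.2.1 - (a.2.1 + b.2.1) * c.1 =
      (a.1 * c.2.1 - a.2.1 * c.1) + (b.1 * c.2.1 - b.2.1 * c.1)
    ring
  lie_add a b c := by
    change ((_, _, _) : K × K × K) = (0 + 0, 0 + 0, _ + _)
    refine Prod.ext (by simp) (Prod.ext (by simp) ?_)
    change a.1 * (b.2.1 + c.2.1) - a.2.1 * (b.1 + c.1) =
      (a.1 * b.2.1 - a.2.1 * b.1) + (a.1 * c.2.1 - a.2.1 * c.1)
    ring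
  lie_self a := by
    refine Prod.ext rfl (Prod.ext rfl ?_)
    change a.1 * a.2.1 - a.2.1 * a.1 = 0
    ring
  leibniz_lie a b c := by
    refine Prod.ext ?_ (Prod.ext ?_ ?_)
    · change (0 : K) = 0 + 0
      simp
    · change (0 : K) = 0 + 0
      simp
    · change a.1 * 0 - a.2.1 * 0 = (0 * c.2.1 - 0 * c.1) + (b.1 * 0 - b.2.1 * 0)
      ring

instance : LieAlgebra ℝ (HeisenbergAlgebra K) where
  lie_smul t a b := by
    refine Prod.ext ?_ (Prod.ext ?_ ?_)
    · change (0 : K) = t • (0 : K)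
      simp
    · change (0 : K) = t • (0 : K)
      simp
    · change a.1 * (t • b.2.1) - a.2.1 * (t • b.1) = t • (a.1 * b.2.1 - a.2.1 * b.1)
      rw [smul_sub, mul_smul_comm, mul_smul_comm]

end HeisenbergAlgebra

/-- The imaginary quaternions. -/
def imQuaternion : Submodule ℝ (Quaternion ℝ) where
  carrier := {q | q.re = 0}
  add_mem' := by
    intro a b ha hb
    simp_all
  zero_mem' := rfl
  smul_mem' := by
    intro t a ha
    simp_all

/-- The 7-dimensional quaternionic Heisenberg Lie algebra `ℍ ⊕ Im ℍ`, with
`[(u, z), (v, w)] = (0, -Im (u v̄))`.  In terms of `X = 1`, `Y = i`, `V = j`, `W = k` in `ℍ` and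
`Z₁ = i`, `Z₂ = j`, `Z₃ = k` in `Im ℍ`:  `[X,Y] = [V,W] = Z₁`, `[X,V] = -[Y,W] = Z₂`,
`[X,W] = [Y,V] = Z₃`. -/
def QuaternionicHeisenberg : Type := Quaternion ℝ × imQuaternion

namespace QuaternionicHeisenberg

noncomputable instance : AddCommGroup QuaternionicHeisenberg :=
  inferInstanceAs (AddCommGroup (Quaternion ℝ × imQuaternion))

noncomputable instance : Module ℝ QuaternionicHeisenberg :=
  inferInstanceAs (Module ℝ (Quaternion ℝ × imQuaternion))

/-- `(u, v) ↦ -Im (u v̄)`. -/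
noncomputable def imBracket (u v : Quaternion ℝ) : imQuaternion :=
  ⟨-(u * star v).im, imQuaternion.neg_mem (show ((u * star v).im).re = 0 from rfl)⟩

noncomputable instance : Bracket QuaternionicHeisenberg QuaternionicHeisenberg :=
  ⟨fun a b => ((0, imBracket a.1 b.1) : Quaternion ℝ × imQuaternion)⟩

noncomputable instance : LieRing QuaternionicHeisenberg where
  add_lie a b c := by
    refine Prod.ext ?_ (Subtype.ext ?_)
    · change (0 : Quaternion ℝ) = 0 + 0
      simp
    · change -((a.1 + b.1) * star c.1).im = -(a.1 * star c.1).im + -(b.1 * star c.1).im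
      ext <;> simp <;> ring
  lie_add a b c := by
    refine Prod.ext ?_ (Subtype.ext ?_)
    · change (0 : Quaternion ℝ) = 0 + 0
      simp
    · change -(a.1 * star (b.1 + c.1)).im = -(a.1 * star b.1).im + -(a.1 * star c.1).im
      ext <;> simp <;> ring
  lie_self a := by
    refine Prod.ext rfl (Subtype.ext ?_)
    change -(a.1 * star a.1).im = 0
    rw [Quaternion.self_mul_star, Quaternion.im_coe, neg_zero]
  leibniz_lie a b c := by
    refine Prod.ext ?_ (Subtype.ext ?_)
    · change (0 : Quaternion ℝ) = 0 + 0
      simp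
    · change -(a.1 * star (0 : Quaternion ℝ)).im =
        -((0 : Quaternion ℝ) * star c.1).im + -(b.1 * star (0 : Quaternion ℝ)).im
      simp only [star_zero, mul_zero, zero_mul]
      rw [show (0 : Quaternion ℝ).im = 0 from rfl, neg_zero, add_zero]

noncomputable instance : LieAlgebra ℝ QuaternionicHeisenberg where
  lie_smul t a b := by
    refine Prod.ext ?_ (Subtype.ext ?_)
    · change (0 : Quaternion ℝ) = t • (0 : Quaternion ℝ)
      simp
    · change -(a.1 * star (t • b.1)).im = t • -(a.1 * star b.1).im
      rw [Quaternion.star_smul, mul_smul_comm, Quaternion.im_smul, smul_neg]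

end QuaternionicHeisenberg

/-!
A metric of type H is the same as a Clifford map `J : 𝔷 → End 𝔳` between Euclidean spaces (each
`J z` is skew-symmetric and `‖z‖` times an isometry), and a Lorentz force `F` of type II is the same
as a linear map `S = F|𝔳 : 𝔳 → 𝔷` for which the cyclic sum of `⟪J (S u) v, w⟫` vanishes.

**A nonzero force bounds the dimensions.**  `S` has a kernel because `dim 𝔷 < dim 𝔳`.  For a unit
vector `u ∈ ker S`, closedness makes `z ↦ S (J z u)` a symmetric operator on `𝔷`; let `zᵢ` be an
orthonormal eigenbasis, with eigenvalues `λᵢ`, and put `Jᵢ = J zᵢ`.  Evaluating the cyclic sum at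
`Jᵢu`, `Jⱼu` and a third vector shows that, for `i ≠ j` with `λᵢ + λⱼ ≠ 0`, the unit vector `JᵢJⱼu`
is a combination of those `Jₖu` with `k ≠ i, j` and `λᵢ + λⱼ + λₖ = 0`
(`IsCliffordMap.map_map_eq_sum`, `IsCliffordMap.inner_map_map_eq_zero`).  So any two eigenvalues with
nonzero sum are completed to a zero sum by a third.  An eigenvalue of largest absolute value is
therefore simple, and looking at how the others pair up with it leaves room for at most three
(`card_le_three_of_sum_zero`): `dim 𝔷 ≤ 3`.  Moreover some `J z` embeds `ker S` into its orthogonal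
complement, so `dim 𝔳 ≤ 2 dim 𝔷`; and for `dim 𝔷 ≥ 2` the space `𝔳` is a quaternionic module, so
`dim 𝔳` is `4` or at least `8`.  Hence `(dim 𝔷, dim 𝔳)` is `(1, 2)`, `(2, 4)` or `(3, 4)`.

**The dimensions determine the algebra.**  In each of the three cases `u`, `J₁u`, `J₂u`, `J₁J₂u` (or
just `u`, `J₁u`) is an orthonormal basis of `𝔳`.  If `dim 𝔷 = 3`, the third basis vector of `𝔷` can be
chosen with `J₃u = J₁J₂u`.  In this frame the bracket has the integer structure constants of the
real, complex or quaternionic Heisenberg algebra.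

**The Heisenberg algebras carry a force for every metric of type H.**  The isomorphism type gives the
dimensions of `𝔷` and `𝔳`, hence a frame as above.  There, the skew-symmetric map with
`Jᵢu ↦ λᵢ zᵢ` and zero on the other vectors of the basis of `𝔳` is closed for `λ = (1)`, `(1, -1)` and
`(2, -1, -1)`, respectively.
-/

open Module

/-! ### Unit vectors and orthonormal families in Euclidean spaces -/

theorem exists_inner_self_eq_one {V : Type*} [NormedAddCommGroup V] [InnerProductSpace ℝ V]
    {p : Submodule ℝ V} (hp : p ≠ ⊥) : ∃ u ∈ p, inner ℝ u u = (1 : ℝ) := by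
  obtain ⟨u, hu, h0⟩ := p.ne_bot_iff.1 hp
  refine ⟨(‖u‖⁻¹ : ℝ) • u, p.smul_mem _ hu, ?_⟩
  rw [real_inner_self_eq_norm_sq, norm_smul, norm_inv, norm_norm,
    inv_mul_cancel₀ (norm_ne_zero_iff.2 h0), one_pow]

theorem exists_inner_self_eq_one_of_finrank {V : Type*} [NormedAddCommGroup V]
    [InnerProductSpace ℝ V] (h : finrank ℝ V ≠ 0) : ∃ u : V, inner ℝ u u = (1 : ℝ) := by
  have : Nontrivial V := nontrivial_of_finrank_pos (R := ℝ) (Nat.pos_of_ne_zero h)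
  obtain ⟨u, -, hu⟩ := exists_inner_self_eq_one (p := (⊤ : Submodule ℝ V)) top_ne_bot
  exact ⟨u, hu⟩

theorem exists_orthonormal_fin {V : Type*} [NormedAddCommGroup V] [InnerProductSpace ℝ V]
    [FiniteDimensional ℝ V] {n : ℕ} (hn : n ≤ finrank ℝ V) :
    ∃ b : Fin n → V, Orthonormal ℝ b :=
  ⟨fun i => stdOrthonormalBasis ℝ V (Fin.castLE hn i),
    (stdOrthonormalBasis ℝ V).orthonormal.comp _ (Fin.castLE_injective hn)⟩

theorem Orthonormal.sum_inner_smul_eq {n : ℕ} {V : Type*} [NormedAddCommGroup V]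
    [InnerProductSpace ℝ V] [FiniteDimensional ℝ V] {b : Fin n → V} (hb : Orthonormal ℝ b)
    (h : finrank ℝ V = n) (x : V) : x = ∑ i, (inner ℝ (b i) x : ℝ) • b i := by
  have hs := hb.linearIndependent.span_eq_top_of_card_eq_finrank' (by simp [h])
  have := (OrthonormalBasis.mk hb hs.ge).sum_repr' x
  simpa using this.symm

/-! ### Clifford maps -/

/-- A linear map `J : Z → End E` between Euclidean spaces such that every `J z` is skew-symmetric
and equal to `‖z‖` times an orthogonal map.  This is the datum of a type H algebra with
center `Z` and `𝔷^⊥ = E`. -/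
structure IsCliffordMap {E Z : Type*} [NormedAddCommGroup E] [InnerProductSpace ℝ E]
    [NormedAddCommGroup Z] [InnerProductSpace ℝ Z] (J : Z →ₗ[ℝ] E →ₗ[ℝ] E) : Prop where
  skew : ∀ z u w, inner ℝ (J z u) w = -inner ℝ u (J z w)
  isometry : ∀ z u w, inner ℝ (J z u) (J z w) = inner ℝ z z * inner ℝ u w

namespace IsCliffordMap

variable {E Z : Type*} [NormedAddCommGroup E] [InnerProductSpace ℝ E]
  [NormedAddCommGroup Z] [InnerProductSpace ℝ Z] {J : Z →ₗ[ℝ] E →ₗ[ℝ] E}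

theorem inner_map_self (hJ : IsCliffordMap J) (z : Z) (u : E) : inner ℝ (J z u) u = 0 := by
  have h := hJ.skew z u u
  rw [real_inner_comm (J z u) u] at h
  linarith

theorem inner_self_map (hJ : IsCliffordMap J) (z : Z) (u : E) : inner ℝ u (J z u) = 0 := by
  rw [real_inner_comm, hJ.inner_map_self]

/-- Polarization of the isometry property. -/
theorem inner_map_map (hJ : IsCliffordMap J) (z z' : Z) (u w : E) :
    inner ℝ (J z u) (J z' w) + inner ℝ (J z' u) (J z w) = 2 * inner ℝ z z' * inner ℝ u w := by
  have h := hJ.isometry (z + z') u w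
  simp only [map_add, LinearMap.add_apply, inner_add_left, inner_add_right, hJ.isometry z,
    hJ.isometry z', real_inner_comm z z'] at h
  linarith

theorem inner_map_map_self (hJ : IsCliffordMap J) (z z' : Z) (u : E) :
    inner ℝ (J z u) (J z' u) = inner ℝ z z' * inner ℝ u u := by
  have h := hJ.inner_map_map z z' u u
  rw [real_inner_comm (J z u) (J z' u)] at h
  linarith

theorem map_map_self (hJ : IsCliffordMap J) (z : Z) (u : E) :
    J z (J z u) = -(inner ℝ z z : ℝ) • u := by
  refine ext_inner_right ℝ fun w => ?_
  rw [hJ.skew, hJ.isometry, inner_smul_left]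
  simp

/-- Orthogonal elements of `Z` anticommute. -/
theorem map_map_of_inner_eq_zero (hJ : IsCliffordMap J) {z z' : Z} (h : inner ℝ z z' = 0) (u : E) :
    J z (J z' u) = -J z' (J z u) := by
  refine ext_inner_right ℝ fun w => ?_
  have h1 := hJ.inner_map_map z z' u w
  rw [inner_neg_left, hJ.skew z, hJ.skew z' (J z u)]
  rw [h] at h1
  linarith

theorem map_injective (hJ : IsCliffordMap J) {z : Z} (hz : z ≠ 0) : Function.Injective (J z) := by
  rw [injective_iff_map_eq_zero]
  intro u hu
  have h := hJ.isometry z u u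
  rw [hu, inner_zero_left] at h
  have hz' : (inner ℝ z z : ℝ) ≠ 0 := inner_self_ne_zero.2 hz
  exact inner_self_eq_zero.1 ((mul_eq_zero.1 h.symm).resolve_left hz')

theorem flip_injective (hJ : IsCliffordMap J) {u : E} (hu : u ≠ 0) :
    Function.Injective (J.flip u) := by
  rw [injective_iff_map_eq_zero]
  intro z hz
  by_contra h
  exact hu (hJ.map_injective h (by simpa using hz))

/-- The quaternionic orbit of a unit vector is an orthonormal family. -/
theorem orthonormal_quaternion (hJ : IsCliffordMap J) {z₁ z₂ : Z} (h₁ : inner ℝ z₁ z₁ = (1 : ℝ))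
    (h₂ : inner ℝ z₂ z₂ = (1 : ℝ)) (h₁₂ : inner ℝ z₁ z₂ = (0 : ℝ)) {u : E}
    (hu : inner ℝ u u = (1 : ℝ)) :
    Orthonormal ℝ ![u, J z₁ u, J z₂ u, J z₁ (J z₂ u)] := by
  have e1 : inner ℝ u (J z₁ (J z₂ u)) = (0 : ℝ) := by
    have := hJ.skew z₁ u (J z₂ u)
    rw [hJ.inner_map_map_self, h₁₂] at this
    linarith
  have e2 : inner ℝ (J z₁ u) (J z₁ (J z₂ u)) = (0 : ℝ) := by
    rw [hJ.isometry, hJ.inner_self_map, mul_zero]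
  have e3 : inner ℝ (J z₂ u) (J z₁ (J z₂ u)) = (0 : ℝ) := hJ.inner_self_map _ _
  have e4 : inner ℝ (J z₁ (J z₂ u)) (J z₁ (J z₂ u)) = (1 : ℝ) := by
    rw [hJ.isometry, hJ.isometry, h₁, h₂, hu, one_mul, one_mul]
  have e5 : ∀ z, z = z₁ ∨ z = z₂ → inner ℝ (J z u) (J z u) = (1 : ℝ) := by
    rintro z (rfl | rfl) <;> simp only [hJ.isometry, h₁, h₂, hu, one_mul]
  have e1' := (real_inner_comm u (J z₁ (J z₂ u))).trans e1
  have e2' := (real_inner_comm (J z₁ u) (J z₁ (J z₂ u))).trans e2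
  have e3' := (real_inner_comm (J z₂ u) (J z₁ (J z₂ u))).trans e3
  have e6 : inner ℝ (J z₁ u) (J z₂ u) = (0 : ℝ) := by rw [hJ.inner_map_map_self, h₁₂, zero_mul]
  have e6' := (real_inner_comm (J z₁ u) (J z₂ u)).trans e6
  rw [orthonormal_iff_ite]
  intro i j
  fin_cases i <;> fin_cases j <;>
    first
    | exact hu
    | exact e4
    | exact e5 _ (.inl rfl)
    | exact e5 _ (.inr rfl)
    | exact hJ.inner_self_map _ _
    | exact hJ.inner_map_self _ _
    | assumption

section FiniteDimensional

variable [FiniteDimensional ℝ E]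

theorem finrank_lt (hJ : IsCliffordMap J) [Nontrivial E] : finrank ℝ Z < finrank ℝ E := by
  obtain ⟨u, hu⟩ := exists_ne (0 : E)
  have h1 := LinearMap.finrank_range_of_inj (hJ.flip_injective hu)
  rw [← h1]
  refine Submodule.finrank_lt fun htop => ?_
  have hmem : u ∈ LinearMap.range (J.flip u) := by rw [htop]; trivial
  obtain ⟨z, hz⟩ := hmem
  have h := hJ.inner_map_self z u
  rw [LinearMap.flip_apply] at hz
  rw [hz] at h
  exact hu (inner_self_eq_zero.1 h)

/-- If `dim Z ≥ 2`, then `E` is a module over the quaternions; in particular, its dimension is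
`4` or at least `8`. -/
theorem finrank_eq_four [FiniteDimensional ℝ Z] (hJ : IsCliffordMap J) [Nontrivial E] (hZ : 2 ≤ finrank ℝ Z)
    (hE : finrank ℝ E < 8) : finrank ℝ E = 4 := by
  obtain ⟨b, hb⟩ := exists_orthonormal_fin hZ
  have hb' := orthonormal_iff_ite.1 hb
  have h₁ : inner ℝ (b 0) (b 0) = (1 : ℝ) := by simpa using hb' 0 0
  have h₂ : inner ℝ (b 1) (b 1) = (1 : ℝ) := by simpa using hb' 1 1
  have h₁₂ : inner ℝ (b 0) (b 1) = (0 : ℝ) := by simpa using hb' 0 1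
  obtain ⟨u, -, hu⟩ := exists_inner_self_eq_one (p := (⊤ : Submodule ℝ E)) top_ne_bot
  have hq := hJ.orthonormal_quaternion h₁ h₂ h₁₂ hu
  set q := ![u, J (b 0) u, J (b 1) u, J (b 0) (J (b 1) u)] with hq_def
  have hspan : finrank ℝ (Submodule.span ℝ (Set.range q)) = 4 := by
    rw [finrank_span_eq_card hq.linearIndependent]; simp
  have hsum := (Submodule.span ℝ (Set.range q)).finrank_add_finrank_orthogonal
  by_cases hbot : (Submodule.span ℝ (Set.range q))ᗮ = ⊥
  · rw [hbot, finrank_bot] at hsum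
    omega
  -- Otherwise the quaternionic orbit of a vector orthogonal to the first orbit is orthogonal to it.
  exfalso
  obtain ⟨w, hw, hw1⟩ := exists_inner_self_eq_one hbot
  have hw' : ∀ i, inner ℝ (q i) w = (0 : ℝ) := fun i =>
    Submodule.mem_orthogonal _ _ |>.1 hw _ (Submodule.subset_span ⟨i, rfl⟩)
  have g0 : inner ℝ u w = (0 : ℝ) := hw' 0
  have g1 : inner ℝ (J (b 0) u) w = (0 : ℝ) := hw' 1
  have g2 : inner ℝ (J (b 1) u) w = (0 : ℝ) := hw' 2
  have g3 : inner ℝ (J (b 0) (J (b 1) u)) w = (0 : ℝ) := hw' 3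
  have hr := hJ.orthonormal_quaternion h₁ h₂ h₁₂ hw1
  set r := ![w, J (b 0) w, J (b 1) w, J (b 0) (J (b 1) w)] with hr_def
  have hrspan : finrank ℝ (Submodule.span ℝ (Set.range r)) = 4 := by
    rw [finrank_span_eq_card hr.linearIndependent]; simp
  have hstable : ∀ z, (z = b 0 ∨ z = b 1) → ∀ x ∈ (Submodule.span ℝ (Set.range q))ᗮ,
      J z x ∈ (Submodule.span ℝ (Set.range q))ᗮ := by
    intro z hz x hx
    have hx' : ∀ i, inner ℝ (q i) x = (0 : ℝ) := fun i =>
      Submodule.mem_orthogonal _ _ |>.1 hx _ (Submodule.subset_span ⟨i, rfl⟩)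
    have k0 : inner ℝ u x = (0 : ℝ) := hx' 0
    have k1 : inner ℝ (J (b 0) u) x = (0 : ℝ) := hx' 1
    have k2 : inner ℝ (J (b 1) u) x = (0 : ℝ) := hx' 2
    have k3 : inner ℝ (J (b 0) (J (b 1) u)) x = (0 : ℝ) := hx' 3
    have h₂₁ := hJ.map_map_of_inner_eq_zero (show inner ℝ (b 1) (b 0) = (0 : ℝ) by
      rw [real_inner_comm, h₁₂])
    rw [← Submodule.span_singleton_le_iff_mem, Submodule.le_orthogonal_iff_le_orthogonal,
      Submodule.span_le]
    rintro _ ⟨i, rfl⟩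
    rw [SetLike.mem_coe, Submodule.mem_orthogonal_singleton_iff_inner_left, ← neg_eq_zero,
      ← hJ.skew]
    rcases hz with rfl | rfl <;> fin_cases i <;>
      simp [hq_def, hJ.map_map_self, h₂₁, inner_neg_left, inner_smul_left, k0, k1, k2, k3]
  have hle : Submodule.span ℝ (Set.range r) ≤ (Submodule.span ℝ (Set.range q))ᗮ := by
    rw [Submodule.span_le]
    rintro _ ⟨i, rfl⟩
    fin_cases i
    · exact hw
    · exact hstable _ (.inl rfl) _ hw
    · exact hstable _ (.inr rfl) _ hw
    · exact hstable _ (.inl rfl) _ (hstable _ (.inr rfl) _ hw)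
  have := Submodule.finrank_mono hle
  omega

end FiniteDimensional

end IsCliffordMap

/-! ### Families of reals with many zero sums -/

/-- The case of `card_le_three_of_sum_zero` in which the member of largest absolute value, `l a`, is
positive.  All other members are then nonpositive, and any two of them sum to `-l a`, so three of
them would be equal to `-l a / 2`. -/
theorem card_le_three_of_sum_zero_of_max {ι : Type*} [Fintype ι] (l : ι → ℝ)
    (hK : ∀ i j, i ≠ j → l i + l j ≠ 0 → ∃ k, k ≠ i ∧ k ≠ j ∧ l k = -(l i + l j))
    (hU : ∀ i j k p, i ≠ j → i ≠ k → j ≠ k → l j = l k → l i + l j ≠ 0 →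
      ¬ ∀ q, l q = -(l i + l j) → q = p)
    (a : ι) (ha : 0 < l a) (hmax : ∀ i, |l i| ≤ l a) : Fintype.card ι ≤ 3 := by
  classical
  have hle : ∀ i, -l a ≤ l i ∧ l i ≤ l a := fun i => abs_le.1 (hmax i)
  -- The extreme eigenvalues are simple, for otherwise twice their negative is an eigenvalue.
  have hs1 : ∀ i, l i = l a → i = a := by
    intro i hi
    by_contra hne
    obtain ⟨k, -, -, hk⟩ := hK i a hne (by linarith)
    linarith [(hle k).1]
  have hs2 : ∀ i j, l i = -l a → l j = -l a → i = j := by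
    intro i j hi hj
    by_contra hne
    obtain ⟨k, -, -, hk⟩ := hK i j hne (by linarith)
    linarith [(hle k).2]
  have hneg : ∀ i, i ≠ a → l i ≤ 0 := by
    intro i hi
    by_cases h0 : l a + l i = 0
    · linarith
    · obtain ⟨k, -, -, hk⟩ := hK a i hi.symm h0
      linarith [(hle k).1]
  have hpair : ∀ i j, i ≠ a → j ≠ a → i ≠ j → l i + l j = -l a := by
    intro i j hi hj hij
    by_cases h0 : l i + l j = 0
    · exfalso
      have hi0 : l i = 0 := by linarith [hneg i hi, hneg j hj]
      have hj0 : l j = 0 := by linarith [hneg i hi, hneg j hj]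
      obtain ⟨k, -, -, hk⟩ := hK a i hi.symm (by linarith)
      exact hU a i j k hi.symm hj.symm hij (by rw [hi0, hj0]) (by linarith)
        fun q hq => hs2 q k (by linarith) (by linarith)
    · obtain ⟨k, -, -, hk⟩ := hK i j hij h0
      have hka : k = a := by
        by_contra hne
        have h1 := hneg k hne
        have h2 := hneg i hi
        have h3 := hneg j hj
        exact h0 (by linarith)
      rw [hka] at hk
      linarith
  by_contra hcard
  have h3 : 2 < (Finset.univ.erase a).card := by
    rw [Finset.card_erase_of_mem (Finset.mem_univ a), Finset.card_univ]
    omega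
  obtain ⟨i, j, k, hi, hj, hk, hij, hik, hjk⟩ := Finset.two_lt_card_iff.1 h3
  have hi := (Finset.mem_erase.1 hi).1
  have hj := (Finset.mem_erase.1 hj).1
  have hk := (Finset.mem_erase.1 hk).1
  have e1 := hpair i j hi hj hij
  have e2 := hpair i k hi hk hik
  exact hU i j k a hij hik hjk (by linarith) (by linarith) fun q hq => hs1 q (by linarith)

/-- Let `l` be a finite family of reals, not all zero, in which any two members with nonzero sum are
completed to a zero sum by a third one (`hK`).  If two equal members `l j = l k` cannot both be
completed, together with `l i`, by one and the same simple member `l p` (`hU`), then the family has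
at most three members. -/
theorem card_le_three_of_sum_zero {ι : Type*} [Fintype ι] (l : ι → ℝ)
    (hK : ∀ i j, i ≠ j → l i + l j ≠ 0 → ∃ k, k ≠ i ∧ k ≠ j ∧ l k = -(l i + l j))
    (hU : ∀ i j k p, i ≠ j → i ≠ k → j ≠ k → l j = l k → l i + l j ≠ 0 →
      ¬ ∀ q, l q = -(l i + l j) → q = p)
    (h0 : ∃ i, l i ≠ 0) : Fintype.card ι ≤ 3 := by
  obtain ⟨i₀, hi₀⟩ := h0
  obtain ⟨a, -, ha⟩ := Finset.exists_max_image Finset.univ (fun i => |l i|) ⟨i₀, Finset.mem_univ _⟩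
  have hpos : 0 < |l a| := (abs_pos.2 hi₀).trans_le (ha i₀ (Finset.mem_univ _))
  rcases lt_or_gt_of_ne (abs_pos.1 hpos) with h | h
  · refine card_le_three_of_sum_zero_of_max (fun i => -l i) ?_ ?_ a (by simpa using h)
      fun i => ?_
    · intro i j hij hne
      obtain ⟨k, h1, h2, h3⟩ := hK i j hij fun e => hne (by linarith)
      exact ⟨k, h1, h2, by linarith⟩
    · intro i j k p hij hik hjk he hne hall
      refine hU i j k p hij hik hjk (by simpa using he) (fun e => hne (by linarith)) ?_
      exact fun q hq => hall q (by linarith)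
    · have := ha i (Finset.mem_univ _)
      rw [abs_neg]
      rwa [abs_of_neg h] at this
  · refine card_le_three_of_sum_zero_of_max l hK hU a h fun i => ?_
    have := ha i (Finset.mem_univ _)
    rwa [abs_of_pos h] at this

/-! ### Closed maps `S : E → Z` and the dimensions of `E` and `Z` -/

/-- Closedness of the alternating form `(u, v, w) ↦ ∑ ⟪J (S u) v, w⟫` (cyclic sum).  For
`S = F|𝔳` this is closedness of the 2-form attached to a map `F` of type II. -/
def IsCliffordClosed {E Z : Type*} [NormedAddCommGroup E] [InnerProductSpace ℝ E]
    [NormedAddCommGroup Z] [InnerProductSpace ℝ Z] (J : Z →ₗ[ℝ] E →ₗ[ℝ] E) (S : E →ₗ[ℝ] Z) : Prop :=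
  ∀ u v w, inner ℝ (J (S u) v) w + inner ℝ (J (S v) w) u + inner ℝ (J (S w) u) v = (0 : ℝ)

namespace IsCliffordMap

variable {E Z : Type*} [NormedAddCommGroup E] [InnerProductSpace ℝ E]
  [NormedAddCommGroup Z] [InnerProductSpace ℝ Z] {J : Z →ₗ[ℝ] E →ₗ[ℝ] E} {S : E →ₗ[ℝ] Z}

/-- On the line of a unit vector `u ∈ ker S`, closedness says that `z ↦ J (S (J z u)) u` is the
adjoint of `S`. -/
theorem inner_map_map_ker (hJ : IsCliffordMap J) (hS : IsCliffordClosed J S) {u : E} (hu : S u = 0)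
    (hu1 : inner ℝ u u = (1 : ℝ)) (z : Z) (w : E) :
    inner ℝ (J (S (J z u)) u) w = (inner ℝ z (S w) : ℝ) := by
  have h := hS u (J z u) w
  rw [hu, map_zero, LinearMap.zero_apply, inner_zero_left, hJ.skew (S (J z u)),
    hJ.inner_map_map_self, hu1, real_inner_comm _ w, real_inner_comm z] at h
  linarith

theorem isSymmetric_comp_flip (hJ : IsCliffordMap J) (hS : IsCliffordClosed J S) {u : E} (hu : S u = 0)
    (hu1 : inner ℝ u u = (1 : ℝ)) : (S ∘ₗ J.flip u).IsSymmetric := by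
  intro z z'
  have h := hJ.inner_map_map_ker hS hu hu1 z (J z' u)
  rw [hJ.inner_map_map_self, hu1, mul_one] at h
  exact h

section Eigenbasis

variable {ι : Type*} [Fintype ι] (b : OrthonormalBasis ι ℝ Z) {l : ι → ℝ} {u : E}

theorem eigenvalue_mul_inner (hJ : IsCliffordMap J) (hS : IsCliffordClosed J S) (hu : S u = 0)
    (hu1 : inner ℝ u u = (1 : ℝ)) (hl : ∀ i, S (J (b i) u) = l i • b i) (i : ι) (w : E) :
    l i * inner ℝ (J (b i) u) w = (inner ℝ (b i) (S w) : ℝ) := by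
  rw [← hJ.inner_map_map_ker hS hu hu1, hl, map_smul, LinearMap.smul_apply, real_inner_smul_left]

theorem eigenvalue_add_mul_inner (hJ : IsCliffordMap J) (hS : IsCliffordClosed J S)
    (hl : ∀ i, S (J (b i) u) = l i • b i) {i j : ι} (hij : i ≠ j) (x : E) :
    (l i + l j) * inner ℝ (J (b i) (J (b j) u)) x =
      -(inner ℝ (J (S x) (J (b i) u)) (J (b j) u) : ℝ) := by
  have h := hS (J (b i) u) (J (b j) u) x
  have h2 : inner ℝ (J (b j) x) (J (b i) u) = (inner ℝ (J (b i) (J (b j) u)) x : ℝ) := by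
    rw [hJ.skew, hJ.map_map_of_inner_eq_zero (b.orthonormal.2 hij.symm), inner_neg_right, neg_neg,
      real_inner_comm]
  simp only [hl, map_smul, LinearMap.smul_apply, real_inner_smul_left, h2] at h
  linarith

theorem inner_map_map_eq_zero (hJ : IsCliffordMap J) (hS : IsCliffordClosed J S)
    (hl : ∀ i, S (J (b i) u) = l i • b i) {i j k : ι} (hij : i ≠ j)
    (hk : ¬ (k ≠ i ∧ k ≠ j ∧ l k = -(l i + l j))) :
    inner ℝ (J (b k) u) (J (b i) (J (b j) u)) = (0 : ℝ) := by
  by_cases hki : k = i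
  · rw [hki, hJ.isometry, hJ.inner_self_map, mul_zero]
  by_cases hkj : k = j
  · rw [hkj, hJ.inner_self_map]
  have h := hJ.eigenvalue_add_mul_inner b hS hl hij (J (b k) u)
  rw [hl, map_smul, LinearMap.smul_apply, real_inner_smul_left,
    hJ.map_map_of_inner_eq_zero (b.orthonormal.2 hki), inner_neg_left,
    hJ.skew (b i) (J (b k) u), real_inner_comm (J (b k) u)] at h
  have h' : (l i + l j + l k) * inner ℝ (J (b k) u) (J (b i) (J (b j) u)) = (0 : ℝ) := by
    linarith
  refine (mul_eq_zero.1 h').resolve_left fun e => hk ⟨hki, hkj, by linarith⟩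

/-- If the eigenvalues of `z_i` and `z_j` have nonzero sum, then `J z_i (J z_j u)` is orthogonal
to `ker S`, hence lies in the span of the `J z_k u`. -/
theorem map_map_eq_sum (hJ : IsCliffordMap J) (hS : IsCliffordClosed J S) (hu : S u = 0)
    (hu1 : inner ℝ u u = (1 : ℝ)) (hl : ∀ i, S (J (b i) u) = l i • b i) {i j : ι} (hij : i ≠ j)
    (hne : l i + l j ≠ 0) :
    J (b i) (J (b j) u) =
      ∑ k, (inner ℝ (J (b k) u) (J (b i) (J (b j) u)) : ℝ) • J (b k) u := by
  classical
  set y := J (b i) (J (b j) u) with hy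
  have hyker : ∀ x, S x = 0 → inner ℝ y x = (0 : ℝ) := by
    intro x hx
    have h := hJ.eigenvalue_add_mul_inner b hS hl hij x
    rw [hx, map_zero, LinearMap.zero_apply, inner_zero_left, neg_zero] at h
    exact (mul_eq_zero.1 h).resolve_left hne
  set s := ∑ k, (inner ℝ (J (b k) u) y : ℝ) • J (b k) u with hs
  have hsk : ∀ k, inner ℝ (J (b k) u) s = (inner ℝ (J (b k) u) y : ℝ) := by
    intro k
    rw [hs, inner_sum, Finset.sum_eq_single k]
    · rw [real_inner_smul_right, hJ.inner_map_map_self, b.inner_eq_one, hu1]; simp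
    · intro k' _ hk'
      rw [real_inner_smul_right, hJ.inner_map_map_self, b.orthonormal.2 hk'.symm]; simp
    · simp
  -- The vectors `J z_k u` with nonzero eigenvalue are orthogonal to `ker S`; the others lie in it.
  have hsker : ∀ x, S x = 0 → inner ℝ s x = (0 : ℝ) := by
    intro x hx
    rw [hs, sum_inner]
    refine Finset.sum_eq_zero fun k _ => ?_
    rw [real_inner_smul_left]
    by_cases h0 : l k = 0
    · rw [real_inner_comm, hyker _ (by rw [hl, h0, zero_smul]), zero_mul]
    · have h := hJ.eigenvalue_mul_inner b hS hu hu1 hl k x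
      rw [hx, inner_zero_right] at h
      rw [(mul_eq_zero.1 h).resolve_left h0, mul_zero]
  have hSys : S (y - s) = 0 := by
    refine InnerProductSpace.ext_inner_left_basis (𝕜 := ℝ) b.toBasis fun k => ?_
    rw [b.coe_toBasis, ← hJ.eigenvalue_mul_inner b hS hu hu1 hl, inner_sub_right, hsk, sub_self,
      mul_zero, inner_zero_right]
  refine sub_eq_zero.1 (inner_self_eq_zero (𝕜 := ℝ).1 ?_)
  rw [inner_sub_left, hyker _ hSys, hsker _ hSys, sub_zero]

theorem inner_map_map_self_eq_one (hJ : IsCliffordMap J) (hu1 : inner ℝ u u = (1 : ℝ)) (i j : ι) :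
    inner ℝ (J (b i) (J (b j) u)) (J (b i) (J (b j) u)) = (1 : ℝ) := by
  rw [hJ.isometry, hJ.isometry, hu1, b.inner_eq_one, b.inner_eq_one]; simp

theorem card_le_three (hJ : IsCliffordMap J) (hS : IsCliffordClosed J S) (hu : S u = 0)
    (hu1 : inner ℝ u u = (1 : ℝ)) (hl : ∀ i, S (J (b i) u) = l i • b i) (h0 : ∃ i, l i ≠ 0) :
    Fintype.card ι ≤ 3 := by
  refine card_le_three_of_sum_zero l ?_ ?_ h0
  · intro i j hij hne
    by_contra hall
    push Not at hall
    have h1 := hJ.inner_map_map_self_eq_one b hu1 i j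
    rw [hJ.map_map_eq_sum b hS hu hu1 hl hij hne, Finset.sum_eq_zero, inner_zero_left] at h1
    · exact zero_ne_one h1
    · intro k _
      rw [hJ.inner_map_map_eq_zero b hS hl hij fun h => hall k h.1 h.2.1 h.2.2, zero_smul]
  · intro i j k p hij hik hjk he hne hall
    -- Both `J z_i (J z_j u)` and `J z_i (J z_k u)` are multiples of `J z_p u`,
    -- but they are orthogonal.
    have key : ∀ j', i ≠ j' → l j' = l j →
        ∃ c : ℝ, c ≠ 0 ∧ J (b i) (J (b j') u) = c • J (b p) u := by
      intro j' hij' hj'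
      have h1 := hJ.map_map_eq_sum b hS hu hu1 hl hij' (by rwa [hj'])
      rw [Finset.sum_eq_single p] at h1
      · refine ⟨_, fun hc => ?_, h1⟩
        rw [hc, zero_smul] at h1
        have h2 := hJ.inner_map_map_self_eq_one b hu1 i j'
        rw [h1, inner_zero_left] at h2
        exact zero_ne_one h2
      · intro q _ hq
        rw [hJ.inner_map_map_eq_zero b hS hl hij' fun h => hq (hall q (by rw [h.2.2, hj'])),
          zero_smul]
      · simp
    obtain ⟨c, hc, h1⟩ := key j hij rfl
    obtain ⟨c', hc', h2⟩ := key k hik he.symm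
    have h3 : inner ℝ (J (b i) (J (b j) u)) (J (b i) (J (b k) u)) = (0 : ℝ) := by
      rw [hJ.isometry, hJ.inner_map_map_self, b.orthonormal.2 hjk]; simp
    rw [h1, h2, real_inner_smul_left, real_inner_smul_right, hJ.inner_map_map_self, hu1,
      b.inner_eq_one] at h3
    simp [hc, hc'] at h3

end Eigenbasis

variable [FiniteDimensional ℝ E] [FiniteDimensional ℝ Z]

theorem ker_ne_bot (hJ : IsCliffordMap J) [Nontrivial E] (S : E →ₗ[ℝ] Z) : LinearMap.ker S ≠ ⊥ := by
  intro h
  have h1 := LinearMap.finrank_le_finrank_of_injective (LinearMap.ker_eq_bot.1 h)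
  have h2 := hJ.finrank_lt
  omega

/-- If `S ≠ 0` is closed, then `J z` embeds `ker S` into its orthogonal complement for a suitable
`z`, whence `dim E` is at most twice the rank of `S`. -/
theorem finrank_le_two_mul (hJ : IsCliffordMap J) (hS : IsCliffordClosed J S) (h0 : S ≠ 0) :
    finrank ℝ E ≤ 2 * finrank ℝ Z := by
  obtain ⟨w, hw⟩ : ∃ w, S w ≠ 0 := by
    by_contra! h
    exact h0 (LinearMap.ext h)
  have hle : (LinearMap.ker S).map (J (S w)) ≤ (LinearMap.ker S)ᗮ := by
    rintro _ ⟨v, hv, rfl⟩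
    rw [Submodule.mem_orthogonal']
    intro u hu
    have h := hS w v u
    rw [LinearMap.mem_ker.1 hv, LinearMap.mem_ker.1 hu] at h
    simpa using h
  have h1 := Submodule.finrank_mono hle
  rw [← (Submodule.equivMapOfInjective _ (hJ.map_injective hw) _).finrank_eq] at h1
  have h2 := (LinearMap.ker S).finrank_add_finrank_orthogonal
  have h3 := LinearMap.finrank_range_add_finrank_ker S
  have h4 := (LinearMap.range S).finrank_le
  omega

/-- The dimensions of `Z` and `E` for which a nonzero closed map can exist. -/
theorem finrank_of_isCliffordClosed (hJ : IsCliffordMap J) (hS : IsCliffordClosed J S) (h0 : S ≠ 0) :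
    (finrank ℝ Z = 1 ∧ finrank ℝ E = 2) ∨ (finrank ℝ Z = 2 ∧ finrank ℝ E = 4) ∨
      (finrank ℝ Z = 3 ∧ finrank ℝ E = 4) := by
  obtain ⟨w, hw⟩ : ∃ w, S w ≠ 0 := by
    by_contra! h
    exact h0 (LinearMap.ext h)
  have : Nontrivial E := ⟨w, 0, fun h => hw (by rw [h, map_zero])⟩
  have : Nontrivial Z := ⟨S w, 0, hw⟩
  obtain ⟨u, hu, hu1⟩ := exists_inner_self_eq_one (hJ.ker_ne_bot S)
  have hA := hJ.isSymmetric_comp_flip hS hu hu1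
  let b := hA.eigenvectorBasis rfl
  have hl : ∀ i, S (J (b i) u) = hA.eigenvalues rfl i • b i := fun i =>
    hA.apply_eigenvectorBasis rfl i
  have h3 : finrank ℝ Z ≤ 3 := by
    have := hJ.card_le_three b hS hu hu1 hl ?_
    · simpa using this
    · by_contra! hall
      refine hw (InnerProductSpace.ext_inner_left_basis (𝕜 := ℝ) b.toBasis fun k => ?_)
      rw [b.coe_toBasis, ← hJ.eigenvalue_mul_inner b hS hu hu1 hl, hall, zero_mul,
        inner_zero_right]
  have h1 : 0 < finrank ℝ Z := finrank_pos
  have h2 := hJ.finrank_le_two_mul hS h0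
  have h4 := hJ.finrank_lt
  by_cases h5 : finrank ℝ Z = 1
  · omega
  · have := hJ.finrank_eq_four (by omega) (by omega)
    omega

end IsCliffordMap

/-! ### Structure constants -/

/-- `L` has a basis `u₁, …, uₙ, z₁, …, zₘ` with `z₁, …, zₘ` central and
`[uᵢ, uⱼ] = ∑ₖ c i j k zₖ`.  The basis is encoded by the coordinate map. -/
def HasStructureConstants {n m : ℕ} (c : Fin n → Fin n → Fin m → ℤ) (L : Type*) [LieRing L]
    [LieAlgebra ℝ L] : Prop :=
  ∃ e : L ≃ₗ[ℝ] (Fin n → ℝ) × (Fin m → ℝ), ∀ x y,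
    e ⁅x, y⁆ = (0, fun k => ∑ i, ∑ j, (c i j k : ℝ) * ((e x).1 i * (e y).1 j))

namespace HasStructureConstants

variable {n m : ℕ} {c : Fin n → Fin n → Fin m → ℤ} {L M : Type*} [LieRing L] [LieAlgebra ℝ L]
  [LieRing M] [LieAlgebra ℝ M]

theorem nonempty_lieEquiv (hL : HasStructureConstants c L) (hM : HasStructureConstants c M) :
    Nonempty (L ≃ₗ⁅ℝ⁆ M) := by
  obtain ⟨e, he⟩ := hL
  obtain ⟨e', he'⟩ := hM
  refine ⟨{ e.trans e'.symm with map_lie' := fun {x y} => ?_ }⟩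
  change e'.symm (e ⁅x, y⁆) = ⁅e'.symm (e x), e'.symm (e y)⁆
  rw [LinearEquiv.symm_apply_eq, he, he']
  simp only [LinearEquiv.apply_symm_apply]

theorem of_lieEquiv (hM : HasStructureConstants c M) (f : L ≃ₗ⁅ℝ⁆ M) :
    HasStructureConstants c L := by
  obtain ⟨e, he⟩ := hM
  refine ⟨f.toLinearEquiv.trans e, fun x y => ?_⟩
  change e (f ⁅x, y⁆) = _
  rw [LieEquiv.map_lie, he]
  rfl

theorem finrank_eq (hL : HasStructureConstants c L) : finrank ℝ L = n + m := by
  obtain ⟨e, -⟩ := hL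
  rw [e.finrank_eq, finrank_prod, finrank_fin_fun, finrank_fin_fun]

/-- If the bracket is nondegenerate on the span of the `uᵢ`, the center is the span of
the `zₖ`. -/
theorem finrank_centerSpace (hL : HasStructureConstants c L)
    (hc : ∀ a : Fin n → ℝ, (∀ j k, ∑ i, (c i j k : ℝ) * a i = 0) → a = 0) :
    finrank ℝ (LieMetric.centerSpace L) = m := by
  have hfin := hL.finrank_eq
  obtain ⟨e, he⟩ := hL
  have : FiniteDimensional ℝ L := e.symm.finiteDimensional
  have hker : LieMetric.centerSpace L =
      LinearMap.ker (LinearMap.fst ℝ (Fin n → ℝ) (Fin m → ℝ) ∘ₗ e.toLinearMap) := by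
    ext x
    rw [LieMetric.mem_centerSpace, LinearMap.mem_ker]
    constructor
    · intro hx
      refine hc _ fun j k => ?_
      have h := he x (e.symm (Pi.single j 1, 0))
      rw [← lie_skew, hx, neg_zero, map_zero] at h
      have h' := congrFun (congrArg Prod.snd h) k
      simpa [Pi.single_apply] using h'.symm
    · intro hx y
      change (e x).1 = 0 at hx
      refine e.injective ?_
      rw [he, hx, map_zero]
      simp only [Pi.zero_apply, mul_zero, Finset.sum_const_zero]
      rfl
  have hrange : LinearMap.range (LinearMap.fst ℝ (Fin n → ℝ) (Fin m → ℝ) ∘ₗ e.toLinearMap) = ⊤ :=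
    LinearMap.range_eq_top.2 (Prod.fst_surjective.comp e.surjective)
  have h := LinearMap.finrank_range_add_finrank_ker
    (LinearMap.fst ℝ (Fin n → ℝ) (Fin m → ℝ) ∘ₗ e.toLinearMap)
  rw [← hker, hrange, finrank_top, finrank_fin_fun] at h
  omega

end HasStructureConstants

/-- Structure constants of the real Heisenberg algebra. -/
def realHeisenbergConstants : Fin 2 → Fin 2 → Fin 1 → ℤ :=
  ![![![0], ![1]], ![![-1], ![0]]]

/-- Structure constants of the quaternionic Heisenberg algebra in the basis `1, i, j, k` of `ℍ` and
`i, j, k` of `Im ℍ`; equivalently, in the basis `u, J₁u, J₂u, J₃u = J₁J₂u`. -/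
def quaternionicHeisenbergConstants : Fin 4 → Fin 4 → Fin 3 → ℤ :=
  ![![![0, 0, 0], ![1, 0, 0], ![0, 1, 0], ![0, 0, 1]],
    ![![-1, 0, 0], ![0, 0, 0], ![0, 0, 1], ![0, -1, 0]],
    ![![0, -1, 0], ![0, 0, -1], ![0, 0, 0], ![1, 0, 0]],
    ![![0, 0, -1], ![0, 1, 0], ![-1, 0, 0], ![0, 0, 0]]]

/-- Structure constants of the complex Heisenberg algebra in the basis `e₁, e₂, ie₂, ie₁, e₃, ie₃`.
In this order, they are the quaternionic ones with the last central direction omitted. -/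
def complexHeisenbergConstants : Fin 4 → Fin 4 → Fin 2 → ℤ :=
  fun i j k => quaternionicHeisenbergConstants i j k.castSucc

theorem realHeisenbergConstants_nondegenerate (a : Fin 2 → ℝ)
    (h : ∀ j k, ∑ i, (realHeisenbergConstants i j k : ℝ) * a i = 0) : a = 0 := by
  have h0 := h 0 0
  have h1 := h 1 0
  simp [realHeisenbergConstants, Fin.sum_univ_succ] at h0 h1
  funext i
  fin_cases i <;> assumption

theorem complexHeisenbergConstants_nondegenerate (a : Fin 4 → ℝ)
    (h : ∀ j k, ∑ i, (complexHeisenbergConstants i j k : ℝ) * a i = 0) : a = 0 := by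
  have h0 := h 0 0
  have h1 := h 1 0
  have h2 := h 2 0
  have h3 := h 3 0
  simp [complexHeisenbergConstants, quaternionicHeisenbergConstants, Fin.sum_univ_four]
    at h0 h1 h2 h3
  funext i
  fin_cases i <;> assumption

theorem quaternionicHeisenbergConstants_nondegenerate (a : Fin 4 → ℝ)
    (h : ∀ j k, ∑ i, (quaternionicHeisenbergConstants i j k : ℝ) * a i = 0) : a = 0 :=
  complexHeisenbergConstants_nondegenerate a fun j k => h j k.castSucc

theorem hasStructureConstants_real :
    HasStructureConstants realHeisenbergConstants (HeisenbergAlgebra ℝ) := by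
  refine ⟨LinearEquiv.mk
    { toFun := fun x => (![x.1, x.2.1], ![x.2.2])
      map_add' := fun x y => Prod.ext (funext fun i => by fin_cases i <;> rfl)
        (funext fun i => by fin_cases i; rfl)
      map_smul' := fun r x => Prod.ext (funext fun i => by fin_cases i <;> rfl)
        (funext fun i => by fin_cases i; rfl) }
    (fun p => ((p.1 0, p.1 1, p.2 0) : ℝ × ℝ × ℝ)) (fun x => rfl)
    (fun p => Prod.ext (funext fun i => by fin_cases i <;> rfl)
      (funext fun i => by fin_cases i; rfl)), fun x y => Prod.ext (funext fun i => ?_)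
      (funext fun k => ?_)⟩
  · fin_cases i <;> rfl
  · fin_cases k
    change x.1 * y.2.1 - x.2.1 * y.1 =
      ∑ i, ∑ j, (realHeisenbergConstants i j 0 : ℝ) *
        ((![x.1, x.2.1] : Fin 2 → ℝ) i *
          (![y.1, y.2.1] : Fin 2 → ℝ) j)
    simp [realHeisenbergConstants, Fin.sum_univ_succ]
    ring

theorem hasStructureConstants_complex :
    HasStructureConstants complexHeisenbergConstants (HeisenbergAlgebra ℂ) := by
  refine ⟨LinearEquiv.mk
    { toFun := fun x => (![x.1.re, x.2.1.re, x.2.1.im, x.1.im], ![x.2.2.re, x.2.2.im])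
      map_add' := fun x y => Prod.ext (funext fun i => by fin_cases i <;> rfl)
        (funext fun i => by fin_cases i <;> rfl)
      map_smul' := fun r x => Prod.ext
        (funext fun i => by
          fin_cases i
          · exact Complex.smul_re r x.1
          · exact Complex.smul_re r x.2.1
          · exact Complex.smul_im r x.2.1
          · exact Complex.smul_im r x.1)
        (funext fun i => by
          fin_cases i
          · exact Complex.smul_re r x.2.2
          · exact Complex.smul_im r x.2.2) }
    (fun p => ((⟨p.1 0, p.1 3⟩, ⟨p.1 1, p.1 2⟩, ⟨p.2 0, p.2 1⟩) : ℂ × ℂ × ℂ)) (fun x => rfl)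
    (fun p => Prod.ext (funext fun i => by fin_cases i <;> rfl)
      (funext fun i => by fin_cases i <;> rfl)), fun x y => Prod.ext (funext fun i => ?_)
      (funext fun k => ?_)⟩
  · fin_cases i <;> rfl
  · fin_cases k
    · change (x.1 * y.2.1 - x.2.1 * y.1).re =
      ∑ i, ∑ j, (complexHeisenbergConstants i j 0 : ℝ) *
        ((![x.1.re, x.2.1.re, x.2.1.im, x.1.im] : Fin 4 → ℝ) i *
          (![y.1.re, y.2.1.re, y.2.1.im, y.1.im] : Fin 4 → ℝ) j)
      simp [complexHeisenbergConstants, quaternionicHeisenbergConstants, Fin.sum_univ_four]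
      ring
    · change (x.1 * y.2.1 - x.2.1 * y.1).im =
      ∑ i, ∑ j, (complexHeisenbergConstants i j 1 : ℝ) *
        ((![x.1.re, x.2.1.re, x.2.1.im, x.1.im] : Fin 4 → ℝ) i *
          (![y.1.re, y.2.1.re, y.2.1.im, y.1.im] : Fin 4 → ℝ) j)
      simp [complexHeisenbergConstants, quaternionicHeisenbergConstants, Fin.sum_univ_four]
      ring

theorem hasStructureConstants_quaternionic :
    HasStructureConstants quaternionicHeisenbergConstants QuaternionicHeisenberg := by
  refine ⟨LinearEquiv.mk
    { toFun := fun x => (![x.1.re, x.1.imI, x.1.imJ, x.1.imK],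
        ![x.2.1.imI, x.2.1.imJ, x.2.1.imK])
      map_add' := fun x y => Prod.ext (funext fun i => by fin_cases i <;> rfl)
        (funext fun i => by fin_cases i <;> rfl)
      map_smul' := fun r x => Prod.ext (funext fun i => by fin_cases i <;> rfl)
        (funext fun i => by fin_cases i <;> rfl) }
    (fun p => ((⟨p.1 0, p.1 1, p.1 2, p.1 3⟩, ⟨⟨0, p.2 0, p.2 1, p.2 2⟩, rfl⟩) :
      Quaternion ℝ × imQuaternion))
    (fun x => Prod.ext rfl (Subtype.ext (QuaternionAlgebra.ext x.2.2.symm rfl rfl rfl)))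
    (fun p => Prod.ext (funext fun i => by fin_cases i <;> rfl)
      (funext fun i => by fin_cases i <;> rfl)), fun x y => Prod.ext (funext fun i => ?_)
      (funext fun k => ?_)⟩
  · fin_cases i <;> rfl
  · fin_cases k
    · change (-(x.1 * star y.1).im).imI =
      ∑ i, ∑ j, (quaternionicHeisenbergConstants i j 0 : ℝ) *
        ((![x.1.re, x.1.imI, x.1.imJ, x.1.imK] : Fin 4 → ℝ) i *
          (![y.1.re, y.1.imI, y.1.imJ, y.1.imK] : Fin 4 → ℝ) j)
      simp [quaternionicHeisenbergConstants, Fin.sum_univ_four]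
      ring
    · change (-(x.1 * star y.1).im).imJ =
      ∑ i, ∑ j, (quaternionicHeisenbergConstants i j 1 : ℝ) *
        ((![x.1.re, x.1.imI, x.1.imJ, x.1.imK] : Fin 4 → ℝ) i *
          (![y.1.re, y.1.imI, y.1.imJ, y.1.imK] : Fin 4 → ℝ) j)
      simp [quaternionicHeisenbergConstants, Fin.sum_univ_four]
      ring
    · change (-(x.1 * star y.1).im).imK =
      ∑ i, ∑ j, (quaternionicHeisenbergConstants i j 2 : ℝ) *
        ((![x.1.re, x.1.imI, x.1.imJ, x.1.imK] : Fin 4 → ℝ) i *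
          (![y.1.re, y.1.imI, y.1.imJ, y.1.imK] : Fin 4 → ℝ) j)
      simp [quaternionicHeisenbergConstants, Fin.sum_univ_four]
      ring

/-! ### Adapted orthonormal frames -/

/-- Orthonormal families `u` of `E` and `z` of `Z`, of full length, in which the Clifford map `J` has
the integer matrices `c`. -/
structure IsCliffordFrame {E Z : Type*} [NormedAddCommGroup E] [InnerProductSpace ℝ E]
    [NormedAddCommGroup Z] [InnerProductSpace ℝ Z] (J : Z →ₗ[ℝ] E →ₗ[ℝ] E) {n m : ℕ}
    (c : Fin n → Fin n → Fin m → ℤ) (u : Fin n → E) (z : Fin m → Z) : Prop where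
  orthonormal_left : Orthonormal ℝ u
  orthonormal_right : Orthonormal ℝ z
  finrank_left : finrank ℝ E = n
  finrank_right : finrank ℝ Z = m
  map_apply : ∀ k i, J (z k) (u i) = ∑ j, (c i j k : ℝ) • u j

namespace IsCliffordMap

variable {E Z : Type*} [NormedAddCommGroup E] [InnerProductSpace ℝ E]
  [NormedAddCommGroup Z] [InnerProductSpace ℝ Z] {J : Z →ₗ[ℝ] E →ₗ[ℝ] E}

theorem exists_frame_real (hJ : IsCliffordMap J) (hZ : finrank ℝ Z = 1) (hE : finrank ℝ E = 2) :
    ∃ u z, IsCliffordFrame J realHeisenbergConstants u z := by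
  obtain ⟨z, hz⟩ := exists_inner_self_eq_one_of_finrank (V := Z) (by omega)
  obtain ⟨u, hu⟩ := exists_inner_self_eq_one_of_finrank (V := E) (by omega)
  refine ⟨![u, J z u], ![z], ?_, ?_, hE, hZ, ?_⟩
  · rw [orthonormal_iff_ite]
    intro i j
    fin_cases i <;> fin_cases j
    · exact hu
    · exact hJ.inner_self_map _ _
    · exact hJ.inner_map_self _ _
    · change inner ℝ (J z u) (J z u) = (1 : ℝ)
      rw [hJ.isometry, hz, hu, one_mul]
  · rw [orthonormal_iff_ite]
    intro i j
    fin_cases i; fin_cases j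
    exact hz
  · intro k i
    fin_cases k
    fin_cases i <;> simp [realHeisenbergConstants, hJ.map_map_self, hz,
      -inner_self_eq_norm_sq_to_K]

theorem exists_frame_complex [FiniteDimensional ℝ Z] (hJ : IsCliffordMap J)
    (hZ : finrank ℝ Z = 2) (hE : finrank ℝ E = 4) :
    ∃ u z, IsCliffordFrame J complexHeisenbergConstants u z := by
  obtain ⟨z, hz⟩ := exists_orthonormal_fin hZ.ge
  obtain ⟨u, hu⟩ := exists_inner_self_eq_one_of_finrank (V := E) (by omega)
  have hz' := orthonormal_iff_ite.1 hz
  have h₁ : inner ℝ (z 0) (z 0) = (1 : ℝ) := by simpa using hz' 0 0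
  have h₂ : inner ℝ (z 1) (z 1) = (1 : ℝ) := by simpa using hz' 1 1
  have h₁₂ : inner ℝ (z 0) (z 1) = (0 : ℝ) := by simpa using hz' 0 1
  have h₂₁ : inner ℝ (z 1) (z 0) = (0 : ℝ) := by rw [real_inner_comm, h₁₂]
  have s₁ : ∀ v, J (z 0) (J (z 0) v) = -v := fun v => by
    rw [hJ.map_map_self, h₁, neg_smul, one_smul]
  have s₂ : ∀ v, J (z 1) (J (z 1) v) = -v := fun v => by
    rw [hJ.map_map_self, h₂, neg_smul, one_smul]
  have a := hJ.map_map_of_inner_eq_zero h₂₁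
  refine ⟨_, z, hJ.orthonormal_quaternion h₁ h₂ h₁₂ hu, hz, hE, hZ, fun k i => ?_⟩
  fin_cases k <;> fin_cases i <;>
    simp [complexHeisenbergConstants, quaternionicHeisenbergConstants, Fin.sum_univ_four, s₁, s₂, a]

theorem exists_frame_quaternionic [FiniteDimensional ℝ E] [FiniteDimensional ℝ Z]
    (hJ : IsCliffordMap J) (hZ : finrank ℝ Z = 3) (hE : finrank ℝ E = 4) :
    ∃ u z, IsCliffordFrame J quaternionicHeisenbergConstants u z := by
  obtain ⟨z, hz⟩ := exists_orthonormal_fin (V := Z) (n := 2) (by omega)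
  obtain ⟨u, hu⟩ := exists_inner_self_eq_one_of_finrank (V := E) (by omega)
  have hz' := orthonormal_iff_ite.1 hz
  have h₁ : inner ℝ (z 0) (z 0) = (1 : ℝ) := by simpa using hz' 0 0
  have h₂ : inner ℝ (z 1) (z 1) = (1 : ℝ) := by simpa using hz' 1 1
  have h₁₂ : inner ℝ (z 0) (z 1) = (0 : ℝ) := by simpa using hz' 0 1
  have h₂₁ : inner ℝ (z 1) (z 0) = (0 : ℝ) := by rw [real_inner_comm, h₁₂]
  have hq := hJ.orthonormal_quaternion h₁ h₂ h₁₂ hu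
  have hq' := orthonormal_iff_ite.1 hq
  have hu0 : u ≠ 0 := fun h => by rw [h, inner_zero_left] at hu; exact zero_ne_one hu
  -- By dimension, `z ↦ J z u` maps onto the orthogonal complement of `u`, which contains `J₁J₂u`.
  obtain ⟨z₃, hz₃⟩ : ∃ z₃, J z₃ u = J (z 0) (J (z 1) u) := by
    have hle : LinearMap.range (J.flip u) ≤ (ℝ ∙ u)ᗮ := by
      rintro _ ⟨x, rfl⟩
      rw [Submodule.mem_orthogonal_singleton_iff_inner_left]
      exact hJ.inner_map_self x u
    have h1 := (ℝ ∙ u).finrank_add_finrank_orthogonal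
    rw [finrank_span_singleton hu0] at h1
    have heq := Submodule.eq_of_le_of_finrank_eq hle (by
      rw [LinearMap.finrank_range_of_inj (hJ.flip_injective hu0)]; omega)
    have hmem : J (z 0) (J (z 1) u) ∈ (ℝ ∙ u)ᗮ := by
      rw [Submodule.mem_orthogonal_singleton_iff_inner_left]
      exact hq' 3 0
    rw [← heq] at hmem
    exact hmem
  have hI : ∀ x y, inner ℝ (J x u) (J y u) = (inner ℝ x y : ℝ) := fun x y => by
    rw [hJ.inner_map_map_self, hu, mul_one]
  have h₃ : inner ℝ z₃ z₃ = (1 : ℝ) := by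
    rw [← hI, hz₃]; exact hq' 3 3
  have h₁₃ : inner ℝ (z 0) z₃ = (0 : ℝ) := by
    rw [← hI, hz₃]; exact hq' 1 3
  have h₂₃ : inner ℝ (z 1) z₃ = (0 : ℝ) := by
    rw [← hI, hz₃]; exact hq' 2 3
  have h₃₁ : inner ℝ z₃ (z 0) = (0 : ℝ) := by rw [real_inner_comm, h₁₃]
  have h₃₂ : inner ℝ z₃ (z 1) = (0 : ℝ) := by rw [real_inner_comm, h₂₃]
  have s₁ : ∀ v, J (z 0) (J (z 0) v) = -v := fun v => by
    rw [hJ.map_map_self, h₁, neg_smul, one_smul]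
  have s₂ : ∀ v, J (z 1) (J (z 1) v) = -v := fun v => by
    rw [hJ.map_map_self, h₂, neg_smul, one_smul]
  have a := hJ.map_map_of_inner_eq_zero h₂₁
  have a₁ := hJ.map_map_of_inner_eq_zero h₃₁
  have a₂ := hJ.map_map_of_inner_eq_zero h₃₂
  refine ⟨_, ![z 0, z 1, z₃], hq, ?_, hE, hZ, fun k i => ?_⟩
  · rw [orthonormal_iff_ite]
    intro i j
    fin_cases i <;> fin_cases j <;> assumption
  · fin_cases k <;> fin_cases i <;>
      simp [quaternionicHeisenbergConstants, Fin.sum_univ_four, s₁, s₂, a, a₁, a₂, hz₃]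

end IsCliffordMap

/-! ### The Clifford map of a type H algebra -/

namespace LieMetric

variable {L : Type*} [LieRing L] [LieAlgebra ℝ L] (g : LieMetric L)

theorem isCompl_centerSpace_vSpace [FiniteDimensional ℝ L] : IsCompl (centerSpace L) g.vSpace := by
  refine LinearMap.BilinForm.isCompl_orthogonal_of_restrict_nondegenerate
    (fun x y h => by rw [g.symm]; exact h) ?_
  constructor
  · intro x hx
    by_contra h
    exact (g.pos x (fun e => h (Subtype.ext e))).ne' (hx x)
  · intro x hx
    by_contra h
    exact (g.pos x (fun e => h (Subtype.ext e))).ne' (hx x)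

theorem exists_add_eq [FiniteDimensional ℝ L] (x : L) :
    ∃ z ∈ centerSpace L, ∃ v ∈ g.vSpace, z + v = x :=
  Submodule.mem_sup.1 (g.isCompl_centerSpace_vSpace.sup_eq_top ▸ Submodule.mem_top)

theorem eq_zero_of_form_self {x : L} (h : g.form x x = 0) : x = 0 := by
  by_contra hx
  exact (g.pos x hx).ne' h

/-- The inner product that the metric induces on a subspace.  The ambient algebra is given no norm:
only the center and `𝔳` are regarded as Euclidean spaces. -/
@[reducible]
def innerCore (p : Submodule ℝ L) : InnerProductSpace.Core ℝ p where
  inner x y := g.form x y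
  conj_inner_symm x y := g.symm y x
  re_inner_nonneg x := by
    by_cases h : (x : L) = 0
    · simp [h]
    · exact (g.pos x h).le
  add_left x y z := by simp
  smul_left x y r := by simp
  definite x h := Subtype.ext (g.eq_zero_of_form_self h)

/-- The norm that the metric induces on a subspace. -/
@[reducible]
noncomputable def normedAddCommGroup (p : Submodule ℝ L) : NormedAddCommGroup p :=
  (g.innerCore p).toNormedAddCommGroup

/-- The Euclidean structure that the metric induces on a subspace. -/
@[reducible]
noncomputable def innerProductSpace (p : Submodule ℝ L) :
    @InnerProductSpace ℝ p _ (g.normedAddCommGroup p).toSeminormedAddCommGroup :=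
  .ofCore (g.innerCore p).toCore

variable [FiniteDimensional ℝ L]

/-- The map `Z ↦ j_Z` on the center. -/
noncomputable def jMap : centerSpace L →ₗ[ℝ] g.vSpace →ₗ[ℝ] g.vSpace where
  toFun z := g.j z
  map_add' z z' := by
    have h : g.bracketForm ((z + z' : centerSpace L) : L) =
        g.bracketForm z + g.bracketForm z' := by
      ext v w
      simp [bracketForm]
    rw [j, h, LinearMap.comp_add]
    rfl
  map_smul' r z := by
    have h : g.bracketForm ((r • z : centerSpace L) : L) = r • g.bracketForm z := by
      ext v w
      simp [bracketForm]
    rw [j, h, LinearMap.comp_smul]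
    rfl

theorem form_jMap (z : centerSpace L) (v w : g.vSpace) :
    g.form (g.jMap z v : L) (w : L) = g.form (z : L) ⁅(v : L), (w : L)⁆ :=
  g.form_j z v w

variable {g}

/-- The orthogonality of `j_Z` for unit `Z`, rescaled to arbitrary `Z`. -/
theorem IsTypeH.form_jMap_jMap (hH : g.IsTypeH) (z : centerSpace L) (v w : g.vSpace) :
    g.form (g.jMap z v : L) (g.jMap z w : L) = g.form (z : L) z * g.form (v : L) w := by
  by_cases hz : (z : L) = 0
  · have : z = 0 := Subtype.ext hz
    simp [this]
  have hpos := g.pos z hz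
  set t := Real.sqrt (g.form (z : L) z) with ht
  have htt : t * t = g.form (z : L) z := Real.mul_self_sqrt hpos.le
  have ht0 : t ≠ 0 := (Real.sqrt_pos.2 hpos).ne'
  have h1 : g.form ((t⁻¹ • z : centerSpace L) : L) (t⁻¹ • z : centerSpace L) = 1 := by
    simp only [Submodule.coe_smul, map_smul, LinearMap.smul_apply, smul_eq_mul, ← htt]
    field_simp
  have h2 := hH.orthogonal_j _ (t⁻¹ • z : centerSpace L).2 h1 v w
  change g.form (g.jMap (t⁻¹ • z) v : L) (g.jMap (t⁻¹ • z) w : L) = _ at h2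
  simp only [map_smul, LinearMap.smul_apply, Submodule.coe_smul, smul_eq_mul] at h2
  rw [← h2, ← htt]
  field_simp

theorem IsTypeH.isCliffordMap (hH : g.IsTypeH) :
    letI := g.normedAddCommGroup (centerSpace L)
    letI := g.innerProductSpace (centerSpace L)
    letI := g.normedAddCommGroup g.vSpace
    letI := g.innerProductSpace g.vSpace
    IsCliffordMap g.jMap := by
  let := g.normedAddCommGroup (centerSpace L)
  let := g.innerProductSpace (centerSpace L)
  let := g.normedAddCommGroup g.vSpace
  let := g.innerProductSpace g.vSpace
  refine ⟨fun z u w => ?_, hH.form_jMap_jMap⟩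
  change g.form (g.jMap z u : L) w = -g.form (u : L) (g.jMap z w)
  rw [g.symm u, g.form_jMap, g.form_jMap, ← lie_skew, map_neg]

theorem IsTypeH.lie_mem_centerSpace (hH : g.IsTypeH) (x y : L) : ⁅x, y⁆ ∈ centerSpace L := by
  rw [mem_centerSpace]
  intro w
  rw [← lie_skew, hH.two_step, neg_zero]

/-- A skew-symmetric map of type II is determined by its restriction to `𝔳`. -/
theorem eq_zero_of_isTypeII {F : L →ₗ[ℝ] L} (hF : ∀ x y, g.form (F x) y = -g.form x (F y))
    (hII : g.IsTypeII F) (h : ∀ v ∈ g.vSpace, F v = 0) : F = 0 := by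
  ext x
  obtain ⟨z, hz, v, hv, rfl⟩ := g.exists_add_eq x
  have h1 : F z = 0 := g.eq_zero_of_form_self (by rw [hF, h _ (hII.map_z z hz), map_zero, neg_zero])
  rw [map_add, h1, h v hv]
  simp

theorem IsTypeH.finrank_of_isLorentzForce (hH : g.IsTypeH) {F : L →ₗ[ℝ] L} (h0 : F ≠ 0)
    (hF : g.IsLorentzForce F) (hII : g.IsTypeII F) :
    (finrank ℝ (centerSpace L) = 1 ∧ finrank ℝ g.vSpace = 2) ∨
      (finrank ℝ (centerSpace L) = 2 ∧ finrank ℝ g.vSpace = 4) ∨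
      (finrank ℝ (centerSpace L) = 3 ∧ finrank ℝ g.vSpace = 4) := by
  let := g.normedAddCommGroup (centerSpace L)
  let := g.innerProductSpace (centerSpace L)
  let := g.normedAddCommGroup g.vSpace
  let := g.innerProductSpace g.vSpace
  let S : g.vSpace →ₗ[ℝ] centerSpace L := F.restrict hII.map_v
  refine hH.isCliffordMap.finrank_of_isCliffordClosed (S := S) (fun u v w => ?_) fun hS => ?_
  · have h := hF.closed u v w
    change g.form (g.jMap (S u) v : L) w + g.form (g.jMap (S v) w : L) u +
      g.form (g.jMap (S w) u : L) v = 0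
    rw [g.form_jMap, g.form_jMap, g.form_jMap]
    exact h
  · refine h0 (eq_zero_of_isTypeII hF.skew hII fun v hv => ?_)
    exact congrArg Subtype.val (LinearMap.congr_fun hS ⟨v, hv⟩)

/-! ### Orthonormal frames of a metric Lie algebra -/

variable {n m : ℕ}

/-- Orthonormal bases `u` of `𝔳` and `z` of the center with `[uᵢ, uⱼ] = ∑ₖ c i j k zₖ`. -/
structure IsFrame (g : LieMetric L) (c : Fin n → Fin n → Fin m → ℤ) (u : Fin n → L)
    (z : Fin m → L) : Prop where
  u_mem : ∀ i, u i ∈ g.vSpace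
  z_mem : ∀ k, z k ∈ centerSpace L
  form_u : ∀ i j, g.form (u i) (u j) = if i = j then 1 else 0
  form_z : ∀ k l, g.form (z k) (z l) = if k = l then 1 else 0
  sum_eq : ∀ x, x = ∑ i, g.form (u i) x • u i + ∑ k, g.form (z k) x • z k
  lie_u : ∀ i j, ⁅u i, u j⁆ = ∑ k, (c i j k : ℝ) • z k

theorem IsTypeH.isFrame (hH : g.IsTypeH) {c : Fin n → Fin n → Fin m → ℤ} {u : Fin n → g.vSpace}
    {z : Fin m → centerSpace L} :
    letI := g.normedAddCommGroup (centerSpace L)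
    letI := g.innerProductSpace (centerSpace L)
    letI := g.normedAddCommGroup g.vSpace
    letI := g.innerProductSpace g.vSpace
    IsCliffordFrame g.jMap c u z → g.IsFrame c (fun i => (u i : L)) (fun k => (z k : L)) := by
  let := g.normedAddCommGroup (centerSpace L)
  let := g.innerProductSpace (centerSpace L)
  let := g.normedAddCommGroup g.vSpace
  let := g.innerProductSpace g.vSpace
  intro h
  have hu : ∀ i j, g.form (u i : L) (u j) = if i = j then 1 else 0 :=
    orthonormal_iff_ite.1 h.orthonormal_left
  have hz : ∀ i j, g.form (z i : L) (z j) = if i = j then 1 else 0 :=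
    orthonormal_iff_ite.1 h.orthonormal_right
  have hsu : ∀ x ∈ g.vSpace, x = ∑ i, g.form (u i : L) x • (u i : L) := fun x hx => by
    have := congrArg Subtype.val (h.orthonormal_left.sum_inner_smul_eq h.finrank_left ⟨x, hx⟩)
    rw [AddSubmonoidClass.coe_finsetSum] at this
    exact this
  have hsz : ∀ x ∈ centerSpace L, x = ∑ k, g.form (z k : L) x • (z k : L) := fun x hx => by
    have := congrArg Subtype.val (h.orthonormal_right.sum_inner_smul_eq h.finrank_right ⟨x, hx⟩)
    rw [AddSubmonoidClass.coe_finsetSum] at this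
    exact this
  refine ⟨fun i => (u i).2, fun k => (z k).2, hu, hz, fun x => ?_, fun i j => ?_⟩
  · obtain ⟨y, hy, v, hv, rfl⟩ := g.exists_add_eq x
    have h1 : ∀ i, g.form (u i : L) (y + v) = g.form (u i : L) v := fun i => by
      rw [map_add, g.symm _ y, g.mem_vSpace.1 (u i).2 y hy, zero_add]
    have h2 : ∀ k, g.form (z k : L) (y + v) = g.form (z k : L) y := fun k => by
      rw [map_add, g.mem_vSpace.1 hv _ (z k).2, add_zero]
    simp only [h1, h2]
    rw [← hsu v hv, ← hsz y hy, add_comm]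
  · refine (hsz _ (hH.lie_mem_centerSpace _ _)).trans (Finset.sum_congr rfl fun k _ => ?_)
    rw [← g.form_jMap, h.map_apply]
    simp [hu]

theorem IsTypeH.exists_isFrame_real (hH : g.IsTypeH) (hZ : finrank ℝ (centerSpace L) = 1)
    (hE : finrank ℝ g.vSpace = 2) : ∃ u z, g.IsFrame realHeisenbergConstants u z := by
  let := g.normedAddCommGroup (centerSpace L)
  let := g.innerProductSpace (centerSpace L)
  let := g.normedAddCommGroup g.vSpace
  let := g.innerProductSpace g.vSpace
  obtain ⟨u, z, h⟩ := hH.isCliffordMap.exists_frame_real hZ hE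
  exact ⟨_, _, hH.isFrame h⟩

theorem IsTypeH.exists_isFrame_complex (hH : g.IsTypeH) (hZ : finrank ℝ (centerSpace L) = 2)
    (hE : finrank ℝ g.vSpace = 4) : ∃ u z, g.IsFrame complexHeisenbergConstants u z := by
  let := g.normedAddCommGroup (centerSpace L)
  let := g.innerProductSpace (centerSpace L)
  let := g.normedAddCommGroup g.vSpace
  let := g.innerProductSpace g.vSpace
  obtain ⟨u, z, h⟩ := hH.isCliffordMap.exists_frame_complex hZ hE
  exact ⟨_, _, hH.isFrame h⟩

theorem IsTypeH.exists_isFrame_quaternionic (hH : g.IsTypeH)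
    (hZ : finrank ℝ (centerSpace L) = 3) (hE : finrank ℝ g.vSpace = 4) :
    ∃ u z, g.IsFrame quaternionicHeisenbergConstants u z := by
  let := g.normedAddCommGroup (centerSpace L)
  let := g.innerProductSpace (centerSpace L)
  let := g.normedAddCommGroup g.vSpace
  let := g.innerProductSpace g.vSpace
  obtain ⟨u, z, h⟩ := hH.isCliffordMap.exists_frame_quaternionic hZ hE
  exact ⟨_, _, hH.isFrame h⟩

end LieMetric

/-! ### Consequences of a frame -/

namespace LieMetric

variable {L : Type*} [LieRing L] [LieAlgebra ℝ L] {g : LieMetric L}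
  {n m : ℕ} {c : Fin n → Fin n → Fin m → ℤ} {u : Fin n → L} {z : Fin m → L}

namespace IsFrame

theorem form_u_z (h : g.IsFrame c u z) (i : Fin n) (k : Fin m) : g.form (u i) (z k) = 0 := by
  rw [g.symm, g.mem_vSpace.1 (h.u_mem i) _ (h.z_mem k)]

theorem form_z_u (h : g.IsFrame c u z) (k : Fin m) (i : Fin n) : g.form (z k) (u i) = 0 :=
  g.mem_vSpace.1 (h.u_mem i) _ (h.z_mem k)

theorem lie_z (h : g.IsFrame c u z) (k : Fin m) (x : L) : ⁅x, z k⁆ = 0 :=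
  mem_centerSpace.1 (h.z_mem k) x

theorem z_lie (h : g.IsFrame c u z) (k : Fin m) (x : L) : ⁅z k, x⁆ = 0 := by
  rw [← lie_skew, h.lie_z, neg_zero]

theorem lie_eq (h : g.IsFrame c u z) (x y : L) :
    ⁅x, y⁆ = ∑ k, (∑ i, ∑ j, (c i j k : ℝ) * (g.form (u i) x * g.form (u j) y)) • z k := by
  conv_lhs => rw [h.sum_eq x, h.sum_eq y]
  simp only [add_lie, lie_add, sum_lie, lie_sum, smul_lie, lie_smul, h.lie_z, h.z_lie, smul_zero,
    Finset.sum_const_zero, add_zero, h.lie_u, Finset.smul_sum, Finset.sum_smul, smul_smul]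
  rw [Finset.sum_comm_cycle]
  refine Finset.sum_congr rfl fun k _ => ?_
  rw [Finset.sum_comm]
  exact Finset.sum_congr rfl fun i _ => Finset.sum_congr rfl fun j _ => by ring_nf

theorem hasStructureConstants (h : g.IsFrame c u z) : HasStructureConstants c L := by
  refine ⟨LinearEquiv.mk
    { toFun := fun x => (fun i => g.form (u i) x, fun k => g.form (z k) x)
      map_add' := fun x y => by simp only [map_add]; rfl
      map_smul' := fun r x => by simp only [map_smul]; rfl }
    (fun p => ∑ i, p.1 i • u i + ∑ k, p.2 k • z k) (fun x => (h.sum_eq x).symm) (fun p => ?_),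
    fun x y => ?_⟩
  · refine Prod.ext (funext fun i => ?_) (funext fun k => ?_)
    · simp [h.form_u, h.form_u_z]
    · simp [h.form_z, h.form_z_u]
  · change ((fun i => g.form (u i) ⁅x, y⁆, fun k => g.form (z k) ⁅x, y⁆) : _ × _) =
      (0, fun k => ∑ i, ∑ j, (c i j k : ℝ) * (g.form (u i) x * g.form (u j) y))
    rw [h.lie_eq x y]
    refine Prod.ext (funext fun i => ?_) (funext fun k => ?_)
    · simp [h.form_u_z]
    · simp [h.form_z]

end IsFrame

/-- The skew-symmetric map with `F uᵢ = ∑ₖ s i k zₖ` and `F zₖ = -∑ᵢ s i k uᵢ` in a frame. -/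
noncomputable def typeIIMap (g : LieMetric L) (u : Fin n → L) (z : Fin m → L)
    (s : Fin n → Fin m → ℤ) : L →ₗ[ℝ] L :=
  ∑ i, ∑ k, (s i k : ℝ) • ((g.form (u i)).smulRight (z k) - (g.form (z k)).smulRight (u i))

theorem typeIIMap_apply (s : Fin n → Fin m → ℤ) (x : L) : g.typeIIMap u z s x =
    ∑ i, ∑ k, (s i k : ℝ) • (g.form (u i) x • z k - g.form (z k) x • u i) := by
  simp [typeIIMap, LinearMap.sum_apply]

theorem form_typeIIMap (s : Fin n → Fin m → ℤ) (x y : L) : g.form (g.typeIIMap u z s x) y =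
    ∑ i, ∑ k, (s i k : ℝ) *
      (g.form (u i) x * g.form (z k) y - g.form (z k) x * g.form (u i) y) := by
  simp [typeIIMap_apply, LinearMap.sum_apply]

namespace IsFrame

theorem isTypeII_typeIIMap (h : g.IsFrame c u z) (s : Fin n → Fin m → ℤ) :
    g.IsTypeII (g.typeIIMap u z s) := by
  refine ⟨fun v hv => ?_, fun y hy => ?_⟩
  · rw [typeIIMap_apply]
    refine Submodule.sum_mem _ fun i _ => Submodule.sum_mem _ fun k _ => Submodule.smul_mem _ _ ?_
    rw [g.mem_vSpace.1 hv _ (h.z_mem k), zero_smul, sub_zero]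
    exact Submodule.smul_mem _ _ (h.z_mem k)
  · rw [typeIIMap_apply]
    refine Submodule.sum_mem _ fun i _ => Submodule.sum_mem _ fun k _ => Submodule.smul_mem _ _ ?_
    rw [g.symm (u i), g.mem_vSpace.1 (h.u_mem i) _ hy, zero_smul, zero_sub]
    exact Submodule.neg_mem _ (Submodule.smul_mem _ _ (h.u_mem i))

theorem form_typeIIMap_lie (h : g.IsFrame c u z) (s : Fin n → Fin m → ℤ) (x v w : L) :
    g.form (g.typeIIMap u z s x) ⁅v, w⁆ = ∑ i, ∑ j, ∑ l,
      ((∑ k, s i k * c j l k : ℤ) : ℝ) *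
        (g.form (u i) x * (g.form (u j) v * g.form (u l) w)) := by
  have h1 : ∀ i, g.form (u i) ⁅v, w⁆ = 0 := fun i => by
    rw [h.lie_eq v w]; simp [h.form_u_z]
  have h2 : ∀ k, g.form (z k) ⁅v, w⁆ =
      ∑ j, ∑ l, (c j l k : ℝ) * (g.form (u j) v * g.form (u l) w) := fun k => by
    rw [h.lie_eq v w]; simp [h.form_z]
  simp only [form_typeIIMap, h1, h2, mul_zero, sub_zero]
  push_cast
  simp only [Finset.mul_sum, Finset.sum_mul]
  refine Finset.sum_congr rfl fun i _ => ?_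
  rw [Finset.sum_comm]
  refine Finset.sum_congr rfl fun j _ => ?_
  rw [Finset.sum_comm]
  exact Finset.sum_congr rfl fun l _ => Finset.sum_congr rfl fun k _ => by ring

/-- Closedness of `typeIIMap` can be tested on the frame. -/
theorem isLorentzForce_typeIIMap (h : g.IsFrame c u z) (s : Fin n → Fin m → ℤ)
    (hs : ∀ i j l, ∑ k, s i k * c j l k + ∑ k, s j k * c l i k + ∑ k, s l k * c i j k = 0) :
    g.IsLorentzForce (g.typeIIMap u z s) := by
  refine ⟨fun x y => ?_, fun x v w => ?_⟩
  · rw [g.symm x, form_typeIIMap, form_typeIIMap]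
    simp only [← Finset.sum_neg_distrib]
    exact Finset.sum_congr rfl fun i _ => Finset.sum_congr rfl fun k _ => by ring
  · rw [h.form_typeIIMap_lie, h.form_typeIIMap_lie, h.form_typeIIMap_lie]
    rw [Finset.sum_comm_cycle (f := fun i j l => ((∑ k, s i k * c j l k : ℤ) : ℝ) *
        (g.form (u i) v * (g.form (u j) w * g.form (u l) x))),
      ← Finset.sum_comm_cycle (f := fun j l i => ((∑ k, s i k * c j l k : ℤ) : ℝ) *
        (g.form (u i) w * (g.form (u j) x * g.form (u l) v)))]
    simp only [← Finset.sum_add_distrib]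
    refine Finset.sum_eq_zero fun i _ => Finset.sum_eq_zero fun j _ =>
      Finset.sum_eq_zero fun l _ => ?_
    have h1 : ((∑ k, s i k * c j l k : ℤ) : ℝ) + ((∑ k, s j k * c l i k : ℤ) : ℝ) +
        ((∑ k, s l k * c i j k : ℤ) : ℝ) = 0 := by exact_mod_cast hs i j l
    linear_combination (g.form (u i) x * (g.form (u j) v * g.form (u l) w)) * h1

theorem exists_lorentzForce (h : g.IsFrame c u z) (s : Fin n → Fin m → ℤ)
    (hs : ∀ i j l, ∑ k, s i k * c j l k + ∑ k, s j k * c l i k + ∑ k, s l k * c i j k = 0)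
    {i₀ : Fin n} {k₀ : Fin m} (h0 : s i₀ k₀ ≠ 0) :
    ∃ F : L →ₗ[ℝ] L, F ≠ 0 ∧ g.IsLorentzForce F ∧ g.IsTypeII F := by
  refine ⟨g.typeIIMap u z s, fun he => h0 ?_, h.isLorentzForce_typeIIMap s hs,
    h.isTypeII_typeIIMap s⟩
  have h1 := form_typeIIMap (g := g) (u := u) (z := z) s (u i₀) (z k₀)
  rw [he] at h1
  simpa [h.form_u, h.form_z, h.form_u_z, h.form_z_u] using h1.symm

end IsFrame

end LieMetric

theorem theorem4p4 {L : Type*} [LieRing L] [LieAlgebra ℝ L] [FiniteDimensional ℝ L]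
    (g : LieMetric L) (hH : g.IsTypeH) :
    (∃ F : L →ₗ[ℝ] L, F ≠ 0 ∧ g.IsLorentzForce F ∧ g.IsTypeII F) ↔
      Nonempty (L ≃ₗ⁅ℝ⁆ HeisenbergAlgebra ℝ) ∨
      Nonempty (L ≃ₗ⁅ℝ⁆ HeisenbergAlgebra ℂ) ∨
      Nonempty (L ≃ₗ⁅ℝ⁆ QuaternionicHeisenberg) := by
  constructor
  · rintro ⟨F, h0, hF, hII⟩
    rcases hH.finrank_of_isLorentzForce h0 hF hII with ⟨h1, h2⟩ | ⟨h1, h2⟩ | ⟨h1, h2⟩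
    · obtain ⟨u, z, h⟩ := hH.exists_isFrame_real h1 h2
      exact .inl (h.hasStructureConstants.nonempty_lieEquiv hasStructureConstants_real)
    · obtain ⟨u, z, h⟩ := hH.exists_isFrame_complex h1 h2
      exact .inr (.inl (h.hasStructureConstants.nonempty_lieEquiv hasStructureConstants_complex))
    · obtain ⟨u, z, h⟩ := hH.exists_isFrame_quaternionic h1 h2
      exact .inr (.inr
        (h.hasStructureConstants.nonempty_lieEquiv hasStructureConstants_quaternionic))
  · have hsum := Submodule.finrank_add_eq_of_isCompl g.isCompl_centerSpace_vSpace
    -- In terms of eigenvalues, the three forces are `(1)`, `(1, -1)` and `(2, -1, -1)`.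
    rintro (⟨⟨f⟩⟩ | ⟨⟨f⟩⟩ | ⟨⟨f⟩⟩)
    · have hc := hasStructureConstants_real.of_lieEquiv f
      have h1 := hc.finrank_centerSpace realHeisenbergConstants_nondegenerate
      have h2 := hc.finrank_eq
      obtain ⟨u, z, h⟩ := hH.exists_isFrame_real h1 (by omega)
      exact h.exists_lorentzForce ![![0], ![1]] (by decide) (i₀ := 1) (k₀ := 0) (by decide)
    · have hc := hasStructureConstants_complex.of_lieEquiv f
      have h1 := hc.finrank_centerSpace complexHeisenbergConstants_nondegenerate
      have h2 := hc.finrank_eq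
      obtain ⟨u, z, h⟩ := hH.exists_isFrame_complex h1 (by omega)
      exact h.exists_lorentzForce ![![0, 0], ![1, 0], ![0, -1], ![0, 0]] (by decide)
        (i₀ := 1) (k₀ := 0) (by decide)
    · have hc := hasStructureConstants_quaternionic.of_lieEquiv f
      have h1 := hc.finrank_centerSpace quaternionicHeisenbergConstants_nondegenerate
      have h2 := hc.finrank_eq
      obtain ⟨u, z, h⟩ := hH.exists_isFrame_quaternionic h1 (by omega)
      exact h.exists_lorentzForce ![![0, 0, 0], ![2, 0, 0], ![0, -1, 0], ![0, 0, -1]] (by decide)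
        (i₀ := 1) (k₀ := 0) (by decide)
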